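/- A (left) skew brace is a set $B$ with two group structures $(B,\cdot)$ and $(B,\circ)$ such that $a\circ(b\cdot c)=(a\circ b)\cdot a^{-1}\cdot(a\circ c)$ for all $a,b,c$, where $a^{-1}$ is the inverse in $(B,\cdot)$; morphisms respect both operations. Skew braces are counted up to isomorphism. Write $\mathbf Z_p^*$ for the unit group of $\mathbf Z/p$. Let $p$ be a prime and $n$ a positive integer not divisible by $p$ such that every group of order $np$ has a normal subgroup of order $p$. For a skew brace $B$ of size $n$ let $\operatorname{Aut}(B)$ be its group of skew brace automorphisms, $\mathrm{Hom}(B,\mathbf Z_p^*)$ the set of maps $B\to\mathbf Z_p^*$ that are homomorphisms for both $\cdot$ and $\circ$, and $H=H_B=\mathrm{Hom}((B,\circ),\mathbf Z_p^*)$. The group $\operatorname{Aut}(B)$ acts on $\mathrm{Hom}(B,\mathbf Z_p^*)$ and on $H$ by composition; for $\sigma\in\mathrm{Hom}(B,\mathbf Z_p^*)$ put $A_\sigma=\operatorname{Aut}(B)\cap\mathrm{Stab}_{\operatorname{Aut}(B,\cdot)}(\sigma)$, and let $R_B$ be a system of representatives for the orbits of $\operatorname{Aut}(B)$ on $\mathrm{Hom}(B,\mathbf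 Z_p^*)$. Let $B$ run over a system of representatives for the isomorphism classes of skew braces of size $n$. An additive structure of skew braces of size $np$ is a pair $(B,\sigma)$ of a skew brace $B$ of size $n$ and a homomorphism $\sigma:(B,\cdot)\to\mathbf Z_p^*$ for which there are a skew brace $C$ of size $np$ and an isomorphism $(C,\cdot)\cong\mathbf Z_p\rtimes_\sigma(B,\cdot)$ such that the projection $C\to B$ is a morphism of skew braces; $(B,\sigma)$ and $(B',\sigma')$ are identified if $\sigma=\sigma'g$ for an isomorphism of skew braces $g:B\to B'$. For $\sigma\in\mathrm{Hom}(B,\mathbf Z_p^*)$ and $\tau\in H$, the double semidirect product of the trivial skew brace $\mathbf Z_p$ and $B$ via $\sigma,\tau$ is $\mathbf Z_p\times B$ with $$(m,a)\cdot(m',a')=(m+\sigma(a)m',\,a\cdot a'),\qquad (m,a)\circ(m',a')=(m+\tau(a)m',\,a\circ a'),$$ the semidirect product via $\tau$ if $\sigma=1$; the mirror double semidirect product has the same $\circ$ and $(m,a)\cdot(m',a')=(\sigma(a')^{-1}m+m',\,a\cdot a')$. **Theorem.** (1) The number of additive structures of skew braces of size $np$ is $$\sum_{B}\frac1{|\operatorname{Aut}(B)|}\sum_{\sigma\in\mathrm{Hom}(B,\mathbf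 Z_p^*)}|\mathrm{Stab}_{\operatorname{Aut}(B)}(\sigma)|=\sum_{B}\frac1{|\operatorname{Aut}(B)|}\sum_{g\in\operatorname{Aut}(B)}|\mathrm{Fix}_{\mathrm{Hom}(B,\mathbf Z_p^*)}(g)|.$$ (2) The total number of skew braces of size $np$ is $$\sum_{B}\Bigl(\frac1{|A_1|}\sum_{\tau\in H}|\mathrm{Stab}_{A_1}(\tau)|+2\sum_{\sigma\in R_B,\ \sigma\ne1}\frac1{|A_\sigma|}\sum_{\tau\in H}|\mathrm{Stab}_{A_\sigma}(\tau)|\Bigr)$$ $$=\sum_{B}\Bigl(\frac1{|A_1|}\sum_{g\in A_1}|\mathrm{Fix}_{H}(g)|+2\sum_{\sigma\in R_B,\ \sigma\ne1}\frac1{|A_\sigma|}\sum_{g\in A_\sigma}|\mathrm{Fix}_{H}(g)|\Bigr).$$ (3) One has $A_1=\operatorname{Aut}(B)$, and the term of $B$ with $\sigma=1$ in the first formula of (2) is the number of skew braces of size $np$ that are semidirect products of the trivial skew brace $\mathbf Z_p$ and $B$. For $\sigma\in R_B$, $\sigma\neq1$, the number $\frac1{|A_\sigma|}\sum_{\tau\in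 H}|\mathrm{Stab}_{A_\sigma}(\tau)|$ counts the skew braces of size $np$ that are double semidirect products via $\sigma$ and some $\tau\in H$; it also counts those that are mirror double semidirect products via $\sigma$ and some $\tau\in H$; and no skew brace is of both kinds for this $\sigma$. Every skew brace of size $np$ is, for exactly one $B$ and exactly one $\sigma\in R_B$, a double or a mirror double semidirect product via $\sigma$ and some $\tau\in H$. -/

import Mathlib

/-- A skew (left) brace: a set `B` with two group structures, the additive one `(B, ·)` (the
`Group` structure of `B`) and the multiplicative one `(B, ∘)` (the field `circGroup`), such that
`a ∘ (b · c) = (a ∘ b) · a⁻¹ · (a ∘ c)`, with `a⁻¹` the inverse of `a` in `(B, ·)`. -/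
class SkewBrace (B : Type*) extends Group B where
  circGroup : Group B
  brace : ∀ a b c : B,
    circGroup.mul a (b * c) = circGroup.mul a b * a⁻¹ * circGroup.mul a c

namespace SkewBrace

/-- The multiplicative operation `a ∘ b` of a skew brace. -/
def circ {B : Type*} [SkewBrace B] (a b : B) : B := (circGroup : Group B).mul a b

/-- A copy of the set `B`, carrying the multiplicative group `(B, ∘)`. -/
def Circ (B : Type*) : Type _ := B

/-- The identity map from `B` to its copy `Circ B`. -/
def toCirc {B : Type*} : B ≃ Circ B := Equiv.refl B

instance {B : Type*} [SkewBrace B] : Group (Circ B) := (circGroup : Group B)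

theorem toCirc_circ {B : Type*} [SkewBrace B] (a b : B) :
    toCirc (circ a b) = toCirc a * toCirc b := rfl

/-- Isomorphisms of skew braces: bijections that respect both operations. -/
structure Iso (A B : Type*) [SkewBrace A] [SkewBrace B] extends A ≃* B where
  map_circ : ∀ a b : A, toFun (circ a b) = circ (toFun a) (toFun b)

namespace Iso

variable {A B C : Type*} [SkewBrace A] [SkewBrace B] [SkewBrace C]

/-- The identity isomorphism. -/
def refl (A : Type*) [SkewBrace A] : Iso A A :=
  { MulEquiv.refl A with map_circ := fun _ _ => rfl }

/-- The inverse isomorphism. -/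
def symm (f : Iso A B) : Iso B A :=
  { f.toMulEquiv.symm with
    map_circ := fun a b => by
      apply f.toMulEquiv.injective
      have h := f.map_circ (f.toMulEquiv.symm a) (f.toMulEquiv.symm b)
      change f.toMulEquiv (circ (f.toMulEquiv.symm a) (f.toMulEquiv.symm b)) =
        circ (f.toMulEquiv (f.toMulEquiv.symm a)) (f.toMulEquiv (f.toMulEquiv.symm b)) at h
      change f.toMulEquiv (f.toMulEquiv.symm (circ a b)) =
        f.toMulEquiv (circ (f.toMulEquiv.symm a) (f.toMulEquiv.symm b))
      rw [h]
      simp }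

/-- The composite of two isomorphisms. -/
def trans (f : Iso A B) (g : Iso B C) : Iso A C :=
  { f.toMulEquiv.trans g.toMulEquiv with
    map_circ := fun a b =>
      (congrArg g.toFun (f.map_circ a b)).trans (g.map_circ (f.toFun a) (f.toFun b)) }

end Iso

section Stabilizers

variable (B : Type*) [SkewBrace B]

/-- `Aut(B)`, the group of skew brace automorphisms, as a subgroup of `Aut(B, ·)`. -/
def autBrace : Subgroup (MulAut B) where
  carrier := {g | ∀ a b : B, g (circ a b) = circ (g a) (g b)}
  one_mem' := fun _ _ => rfl
  mul_mem' := fun {g h} hg hh a b => by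
    change g (h (circ a b)) = circ (g (h a)) (g (h b))
    rw [hh, hg]
  inv_mem' := fun {g} hg a b => by
    apply g.injective
    rw [hg]
    simp

variable (p : ℕ)

/-- `Hom(B, ℤ_p^*)`: the maps to the group `ℤ_p^*` that are homomorphisms both for `·` and for
`∘`, i.e. the morphisms of skew braces to the trivial skew brace on `ℤ_p^*`. -/
def braceHom : Set (B →* (ZMod p)ˣ) := {σ | ∀ a b : B, σ (circ a b) = σ a * σ b}

variable {B p}

/-- The stabilizer in `Aut(B, ·)` of `σ ∈ Hom((B, ·), ℤ_p^*)` under `(g, σ) ↦ σ g`. -/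
def stabDot (σ : B →* (ZMod p)ˣ) : Subgroup (MulAut B) where
  carrier := {g | ∀ b : B, σ (g b) = σ b}
  one_mem' := fun _ => rfl
  mul_mem' := fun {g h} hg hh b => (hg (h b)).trans (hh b)
  inv_mem' := fun {g} hg b => by
    have h := hg (g⁻¹ b)
    rw [MulAut.apply_inv_self] at h
    exact h.symm

/-- The automorphisms `g ∈ Aut(B, ·)` with `τ g = τ`, for `τ ∈ Hom((B, ∘), ℤ_p^*)`. -/
def stabCirc (τ : Circ B →* (ZMod p)ˣ) : Subgroup (MulAut B) where
  carrier := {g | ∀ b : B, τ (toCirc (g b)) = τ (toCirc b)}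
  one_mem' := fun _ => rfl
  mul_mem' := fun {g h} hg hh b => (hg (h b)).trans (hh b)
  inv_mem' := fun {g} hg b => by
    have h := hg (g⁻¹ b)
    rw [MulAut.apply_inv_self] at h
    exact h.symm

/-- `A_σ = Aut(B) ∩ Stab_{Aut(B, ·)}(σ)`. -/
def autStab (σ : B →* (ZMod p)ˣ) : Subgroup (MulAut B) := autBrace B ⊓ stabDot σ

/-- The set of fixed points of `g` in `Hom(B, ℤ_p^*)`. -/
def fixBraceHom (p : ℕ) (g : MulAut B) : Set (B →* (ZMod p)ˣ) :=
  {σ | σ ∈ braceHom B p ∧ ∀ b : B, σ (g b) = σ b}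

/-- The set of fixed points of `g` in `H = Hom((B, ∘), ℤ_p^*)`. -/
def fixCircHom (p : ℕ) (g : MulAut B) : Set (Circ B →* (ZMod p)ˣ) :=
  {τ | ∀ b : B, τ (toCirc (g b)) = τ (toCirc b)}

/-- `R` is a system of representatives for the orbits of `Aut(B)` on `Hom(B, ℤ_p^*)`. -/
def IsOrbitReps (R : Set (B →* (ZMod p)ˣ)) : Prop :=
  R ⊆ braceHom B p ∧
    ∀ σ ∈ braceHom B p, ∃! r, r ∈ R ∧ ∃ g ∈ autBrace B, ∀ b : B, σ (g b) = r b

end Stabilizers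

section Products

variable {p : ℕ} {B : Type*} [SkewBrace B]

/-- The skew brace `C` is isomorphic to the double semidirect product of the trivial brace `ℤ_p`
and `B` via `σ` and `τ`, i.e. to `ℤ_p × B` with
`(m, a) · (n, b) = (m + σ(a) n, a · b)` and `(m, a) ∘ (n, b) = (m + τ(a) n, a ∘ b)`
(here `Aut(ℤ_p)` is identified with `ℤ_p^*`). For `σ = 1` this is the semidirect product of the
two skew braces via `τ`. -/
def IsDoubleSemidirect (C : Type*) [SkewBrace C] (σ : B →* (ZMod p)ˣ)
    (τ : Circ B →* (ZMod p)ˣ) : Prop :=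
  ∃ e : C ≃ ZMod p × B,
    (∀ x y : C, e (x * y) = ((e x).1 + (σ (e x).2 : ZMod p) * (e y).1, (e x).2 * (e y).2)) ∧
    ∀ x y : C, e (circ x y) =
      ((e x).1 + (τ (toCirc (e x).2) : ZMod p) * (e y).1, circ (e x).2 (e y).2)

/-- The mirror version, in which `ℤ_p` is written as the right hand factor of the additive group:
`C` is isomorphic to `ℤ_p × B` with
`(m, a) · (n, b) = (σ(b)⁻¹ m + n, a · b)` and `(m, a) ∘ (n, b) = (m + τ(a) n, a ∘ b)`.
The map `(m, a) ↦ (σ(a) m, a)` identifies this additive group with `ℤ_p ⋊_σ (B, ·)`. -/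
def IsMirrorDoubleSemidirect (C : Type*) [SkewBrace C] (σ : B →* (ZMod p)ˣ)
    (τ : Circ B →* (ZMod p)ˣ) : Prop :=
  ∃ e : C ≃ ZMod p × B,
    (∀ x y : C, e (x * y) =
      (((σ (e y).2)⁻¹ : (ZMod p)ˣ) * (e x).1 + (e y).1, (e x).2 * (e y).2)) ∧
    ∀ x y : C, e (circ x y) =
      ((e x).1 + (τ (toCirc (e x).2) : ZMod p) * (e y).1, circ (e x).2 (e y).2)

/-- The skew brace `C` has additive structure `(B, σ)`: the group `(C, ·)` is isomorphic to
`ℤ_p ⋊_σ (B, ·)` in such a way that the projection `C → B` is a morphism of skew braces. -/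
def HasAdditiveStructure (C : Type*) [SkewBrace C] (σ : B →* (ZMod p)ˣ) : Prop :=
  ∃ e : C ≃ ZMod p × B,
    (∀ x y : C, e (x * y) = ((e x).1 + (σ (e x).2 : ZMod p) * (e y).1, (e x).2 * (e y).2)) ∧
    ∀ x y : C, (e (circ x y)).2 = circ (e x).2 (e y).2

end Products

end SkewBrace

open SkewBrace

/-- The skew braces of size `m`. -/
structure FinSkewBrace (m : ℕ) where
  carrier : Type
  [str : SkewBrace carrier]
  [fin : Finite carrier]
  card_eq : Nat.card carrier = m

namespace FinSkewBrace

instance (m : ℕ) : CoeSort (FinSkewBrace m) Type := ⟨FinSkewBrace.carrier⟩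

instance {m : ℕ} (B : FinSkewBrace m) : SkewBrace B := B.str

instance {m : ℕ} (B : FinSkewBrace m) : Finite B := B.fin

/-- Isomorphism of skew braces of size `m`. -/
instance isoSetoid (m : ℕ) : Setoid (FinSkewBrace m) where
  r A B := Nonempty (Iso A B)
  iseqv :=
    { refl := fun A => ⟨Iso.refl A⟩
      symm := fun ⟨f⟩ => ⟨f.symm⟩
      trans := fun ⟨f⟩ ⟨g⟩ => ⟨f.trans g⟩ }

/-- The number of isomorphism classes of skew braces of size `m`. -/
noncomputable def count (m : ℕ) : ℕ := Nat.card (Quotient (isoSetoid m))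

/-- The number of isomorphism classes of skew braces of size `m` with the property `P`. -/
noncomputable def countWith (m : ℕ) (P : FinSkewBrace m → Prop) : ℕ :=
  Nat.card {q : Quotient (isoSetoid m) // ∃ C : FinSkewBrace m, P C ∧ Quotient.mk _ C = q}

/-- `B` is a system of representatives for the isomorphism classes of skew braces of size `m`. -/
def IsReps {m : ℕ} {ι : Type} (B : ι → FinSkewBrace m) : Prop :=
  ∀ C : FinSkewBrace m, ∃! i, Nonempty (Iso C (B i))

end FinSkewBrace

/-- The additive structures of skew braces of size `np`: the pairs of a skew brace `B` of size `n`
and a homomorphism `σ : (B, ·) → ℤ_p^*` for which there is a skew brace of size `np` with additive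
structure `(B, σ)`. -/
structure NpAdditiveStructure (n p : ℕ) where
  B : FinSkewBrace n
  σ : B →* (ZMod p)ˣ
  realized : ∃ C : FinSkewBrace (n * p), HasAdditiveStructure C σ

namespace NpAdditiveStructure

/-- `(B, σ)` and `(B', σ')` are identified if `σ = σ' g` for a skew brace isomorphism
`g : B → B'`. -/
instance isoSetoid (n p : ℕ) : Setoid (NpAdditiveStructure n p) where
  r X Y := ∃ g : Iso X.B Y.B, ∀ b, Y.σ (g.toFun b) = X.σ b
  iseqv :=
    { refl := fun X => ⟨Iso.refl X.B, fun _ => rfl⟩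
      symm := fun {X Y} ⟨g, hg⟩ => ⟨g.symm, fun b => by
        have h := hg (g.toMulEquiv.symm b)
        change Y.σ (g.toMulEquiv (g.toMulEquiv.symm b)) = X.σ (g.toMulEquiv.symm b) at h
        rw [MulEquiv.apply_symm_apply] at h
        exact h.symm⟩
      trans := fun ⟨g, hg⟩ ⟨h, hh⟩ => ⟨g.trans h, fun b => (hh (g.toFun b)).trans (hg b)⟩ }

/-- The number of additive structures of skew braces of size `np`, up to isomorphism. -/
noncomputable def count (n p : ℕ) : ℕ := Nat.card (Quotient (isoSetoid n p))

end NpAdditiveStructure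

open FinSkewBrace

/-! Let `C` be a skew brace of size `np`. In either of its groups a normal subgroup of order `p` has
index prime to `p`, so it consists of all elements of exponent `p`. In `(C, ·)` it is therefore
preserved by every `λ_a : b ↦ a⁻¹ · (a ∘ b)`, hence closed under `∘`, and it agrees with the one in
`(C, ∘)`. So it is an ideal, `C` is an extension of a skew brace `B` of size `n` by `ℤ_p`, and
conjugation in the two groups gives characters `σ` and `τ` of `B` (`exists_isBraceExt`). Comparing
conjugation with `λ` shows that `σ` respects both operations (`char_lam`, `mem_braceHom_of_ext`).

The main point is a dichotomy (`IsBraceExt.circ_base_eq`). For `x` in the kernel, `λ_x` shifts the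
cosets of the kernel by a crossed homomorphism on `B`, which is principal because `|B|` is
invertible mod `p`. Hence `x ∘ c` is governed by a single constant `k ∈ ℤ_p`, and multiplicativity
of the actions on the kernel forces `k = 0` or `k = -1` unless `σ = 1`. These values mean `x ∘ c = x
· c` and `x ∘ c = c · x`. In the first case a splitting of the additive extension, averaged over the
multiplicative group, splits both extensions at once, so `C` is a double semidirect product
(`isDoubleSemidirect_iff`). Passing to the opposite skew brace turns the second case into the first.
For `σ ≠ 1` the cases exclude each other, and for `σ = 1` they coincide: hence the factor 2.

An isomorphism of extensions preserves the kernels, so it induces an isomorphism of the quotients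
compatible with `σ` and `τ` (`exists_base_iso`); conversely, such an isomorphism lifts to products
of the same kind. Thus the classes for fixed `B`, `σ` and kind are the orbits of `A_σ` on `H`, the
additive structures over `B` are the orbits of `Aut(B)` on `Hom(B, ℤ_p^*)`, and orbit counting gives
both forms of each formula. -/

/-! ### Group extensions by `ℤ_p` with quotient of order prime to `p` -/

/-- An extension of a group `Q` by `ℤ_p`, written `ℤ_p → G → Q`, with `Q` acting on `ℤ_p` by `χ`. -/
structure IsPrimeExt {p : ℕ} {G Q : Type*} [Group G] [Group Q] (φ : ZMod p → G) (π : G →* Q)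
    (χ : Q →* (ZMod p)ˣ) : Prop where
  map_add : ∀ x y, φ (x + y) = φ x * φ y
  inj : Function.Injective φ
  surj : Function.Surjective π
  ker : ∀ g, π g = 1 ↔ ∃ x, φ x = g
  conj : ∀ g x, g * φ x = φ (χ (π g) * x) * g

/-- A crossed homomorphism `G → ℤ_p` that restricts to the identity on the kernel. -/
structure IsSplitting {p : ℕ} {G Q : Type*} [Group G] [Group Q] (φ : ZMod p → G) (π : G →* Q)
    (χ : Q →* (ZMod p)ˣ) (m : G → ZMod p) : Prop where
  map_mul : ∀ c d, m (c * d) = m c + χ (π c) * m d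
  map_base : ∀ x, m (φ x) = x

theorem additive_eq_mul {p : ℕ} (f : ZMod p → ZMod p) (hf : ∀ x y, f (x + y) = f x + f y)
    (x : ZMod p) : f x = f 1 * x := by
  have h := ((AddMonoidHom.mk' f hf).toZModLinearMap p).map_smul x 1
  simpa [mul_comm] using h

/-- Additive maps of `ℤ_p` are multiplications by scalars; the scalars of a group action are
multiplicative, and values of a monoid homomorphism on a group are units. -/
theorem exists_units_hom_of_additive {p : ℕ} {G : Type*} [Group G] (act : G → ZMod p → ZMod p)
    (hadd : ∀ g x y, act g (x + y) = act g x + act g y)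
    (hmul : ∀ g h x, act (g * h) x = act g (act h x)) (hone : ∀ x, act 1 x = x) :
    ∃ χ : G →* (ZMod p)ˣ, ∀ g x, act g x = χ g * x := by
  let f : G →* ZMod p :=
    { toFun := fun g => act g 1
      map_one' := hone 1
      map_mul' := fun g h => by
        rw [hmul]
        exact additive_eq_mul (act g) (hadd g) _ }
  exact ⟨f.toHomUnits, fun g x => additive_eq_mul (act g) (hadd g) x⟩

/-- By Fermat a unit `u` mod `p` has `u ^ p = u`. This makes the kernel of an extension act
trivially on itself. -/
theorem units_hom_eq_one_of_pow {p : ℕ} (hp : p.Prime) {G : Type*} [Group G] (χ : G →* (ZMod p)ˣ)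
    {g : G} (hg : g ^ p = 1) : χ g = 1 := by
  have := Fact.mk hp
  have h1 : (χ g) ^ p = 1 := by rw [← map_pow, hg, map_one]
  have h2 : (χ g) ^ (p - 1) = 1 := ZMod.units_pow_card_sub_one_eq_one p _
  have h3 : χ g ^ p = χ g ^ (p - 1) * χ g := by rw [← pow_succ, Nat.sub_add_cancel hp.pos]
  rwa [h3, h2, one_mul] at h1

theorem exists_hom_factor {G Q U : Type*} [Group G] [Group Q] [Group U] (π : G →* Q)
    (hπ : Function.Surjective π) (χ : G →* U) (h : ∀ g, π g = 1 → χ g = 1) :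
    ∃ χ' : Q →* U, ∀ g, χ' (π g) = χ g :=
  ⟨π.liftOfSurjective hπ ⟨χ, fun g hg => h g hg⟩, fun g =>
    π.liftOfRightInverse_comp_apply _ (Function.rightInverse_surjInv hπ) ⟨χ, fun g hg => h g hg⟩ g⟩

/-- A crossed homomorphism into `ℤ_p` on a group of order prime to `p` is principal. -/
theorem crossed_hom_principal {p : ℕ} {Q : Type*} [Group Q] [Fintype Q]
    (hQ : IsUnit (Nat.card Q : ZMod p)) (χ : Q →* (ZMod p)ˣ) (D : Q → ZMod p)
    (hD : ∀ q r, D (q * r) = D q + χ q * D r) (q : Q) :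
    D q = (1 - χ q) * ((Nat.card Q : ZMod p)⁻¹ * ∑ r, D r) := by
  -- Translating the summation variable by `q` leaves the sum over the group unchanged.
  have h : ∑ r, D r = Nat.card Q * D q + χ q * ∑ r, D r := by
    conv_lhs => rw [← Equiv.sum_comp (Equiv.mulLeft q)]
    simp [hD, Finset.sum_add_distrib, Finset.mul_sum, Nat.card_eq_fintype_card]
  have hi : (Nat.card Q : ZMod p)⁻¹ * Nat.card Q = 1 := ZMod.inv_mul_of_unit _ hQ
  linear_combination (-D q) * hi - (Nat.card Q : ZMod p)⁻¹ * h

namespace IsPrimeExt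

variable {p : ℕ} {G Q : Type*} [Group G] [Group Q] {φ : ZMod p → G} {π : G →* Q}
  {χ : Q →* (ZMod p)ˣ}

theorem map_zero (h : IsPrimeExt φ π χ) : φ 0 = 1 := by
  have := h.map_add 0 0
  simpa using this

theorem map_base (h : IsPrimeExt φ π χ) (x : ZMod p) : π (φ x) = 1 := (h.ker _).2 ⟨x, rfl⟩

theorem exists_of_eq (h : IsPrimeExt φ π χ) {c d : G} (hcd : π c = π d) : ∃ x, c = φ x * d := by
  obtain ⟨x, hx⟩ := (h.ker (c * d⁻¹)).1 (by simp [hcd])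
  exact ⟨x, by simp [hx]⟩

theorem pow_base (h : IsPrimeExt φ π χ) (x : ZMod p) (k : ℕ) : φ x ^ k = φ (k * x) := by
  induction k with
  | zero => simp [h.map_zero]
  | succ k ih => rw [pow_succ, ih, ← h.map_add]; push_cast; ring_nf

/-- The kernel consists of the elements of exponent `p`. -/
theorem ker_iff_pow (h : IsPrimeExt φ π χ) [Finite Q] (hQ : (Nat.card Q).Coprime p) (g : G) :
    π g = 1 ↔ g ^ p = 1 := by
  constructor
  · intro hg
    obtain ⟨x, rfl⟩ := (h.ker g).1 hg
    simp [h.pow_base, h.map_zero]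
  · intro hg
    have h1 : (π g) ^ p = 1 := by rw [← _root_.map_pow, hg, map_one]
    have h2 : orderOf (π g) ∣ p := orderOf_dvd_of_pow_eq_one h1
    have h3 : orderOf (π g) ∣ Nat.card Q := orderOf_dvd_natCard _
    have := Nat.dvd_gcd h3 h2
    rw [hQ.gcd_eq_one] at this
    exact orderOf_eq_one_iff.1 (Nat.dvd_one.1 this)

/-- The average of the functions `d ↦ χ(c)⁻¹ (m (c d) - m c)` over representatives `c` of `Q`. -/
noncomputable def average [Fintype Q] (h : IsPrimeExt φ π χ) (m : G → ZMod p) (d : G) : ZMod p :=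
  (Nat.card Q : ZMod p)⁻¹ * ∑ q : Q,
    (((χ q)⁻¹ : (ZMod p)ˣ) : ZMod p) *
      (m (Function.surjInv h.surj q * d) - m (Function.surjInv h.surj q))

/-- Equivariance of `m` under the kernel makes each summand independent of the chosen
representative, so right translation merely permutes the summands up to the factor `χ`. -/
theorem average_isSplitting [Fintype Q] (h : IsPrimeExt φ π χ)
    (hQ : IsUnit (Nat.card Q : ZMod p)) (m : G → ZMod p)
    (hm : ∀ x c, m (φ x * c) = x + m c) : IsSplitting φ π χ (h.average m) := by
  set s := Function.surjInv h.surj with hs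
  have hπs : ∀ q, π (s q) = q := Function.surjInv_eq h.surj
  have hi : (Nat.card Q : ZMod p)⁻¹ * Nat.card Q = 1 := ZMod.inv_mul_of_unit _ hQ
  constructor
  · intro c d
    have key : ∑ q : Q, (((χ q)⁻¹ : (ZMod p)ˣ) : ZMod p) * (m (s q * (c * d)) - m (s q * c)) =
        χ (π c) * ∑ q : Q, (((χ q)⁻¹ : (ZMod p)ˣ) : ZMod p) * (m (s q * d) - m (s q)) := by
      rw [Finset.mul_sum, ← Equiv.sum_comp (Equiv.mulRight (π c)) (fun q =>
        (χ (π c) : ZMod p) * ((((χ q)⁻¹ : (ZMod p)ˣ) : ZMod p) * (m (s q * d) - m (s q))))]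
      refine Finset.sum_congr rfl fun q _ => ?_
      -- `s q * c` and `s (q * π c)` represent the same class; their discrepancy `x` cancels in the
      -- difference of values of `m`.
      obtain ⟨x, hx⟩ := h.exists_of_eq (c := s q * c) (d := s (q * π c)) (by simp [hπs])
      rw [← mul_assoc, hx, mul_assoc, hm, hm]
      simp only [Equiv.coe_mulRight, map_mul, mul_inv_rev, Units.val_mul]
      have := (χ (π c)).mul_inv
      linear_combination (-(((χ q)⁻¹ : (ZMod p)ˣ) : ZMod p) *
        (m (s (q * π c) * d) - m (s (q * π c)))) * this
    simp only [average, ← hs]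
    rw [mul_left_comm, ← key, ← mul_add, ← Finset.sum_add_distrib]
    congr 1
    exact Finset.sum_congr rfl fun q _ => by ring
  · intro x
    simp only [average, ← hs]
    have : ∀ q, (((χ q)⁻¹ : (ZMod p)ˣ) : ZMod p) * (m (s q * φ x) - m (s q)) = x := by
      intro q
      rw [h.conj, hm, hπs]
      have := (χ q).inv_mul
      linear_combination x * this
    simp only [this, Finset.sum_const, Finset.card_univ, nsmul_eq_mul, ← Nat.card_eq_fintype_card]
    linear_combination x * hi

/-- Averaging is linear. This is used to see that averaging over the multiplicative group preserves
the crossed homomorphism property for the additive one. -/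
theorem average_eq_add [Fintype Q] (h : IsPrimeExt φ π χ) {m : G → ZMod p} {c d₁ d₂ : G}
    {k : ZMod p} (hm : ∀ a, m (a * c) - m a = m (a * d₁) - m a + k * (m (a * d₂) - m a)) :
    h.average m c = h.average m d₁ + k * h.average m d₂ := by
  simp only [average]
  rw [mul_left_comm, ← mul_add, Finset.mul_sum _ _ k, ← Finset.sum_add_distrib]
  congr 1
  refine Finset.sum_congr rfl fun q _ => ?_
  rw [hm]
  ring

theorem exists_splitting [Finite Q] (h : IsPrimeExt φ π χ)
    (hQ : IsUnit (Nat.card Q : ZMod p)) : ∃ m, IsSplitting φ π χ m := by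
  have := Fintype.ofFinite Q
  have hπs : ∀ q, π (Function.surjInv h.surj q) = q := Function.surjInv_eq h.surj
  -- The kernel coordinate relative to an arbitrary set-theoretic section; it is equivariant under
  -- the kernel, so averaging makes it a splitting.
  choose m hm using fun c => h.exists_of_eq (hπs (π c)).symm
  refine ⟨_, h.average_isSplitting hQ m fun x c => h.inj ?_⟩
  have h1 := hm (φ x * c)
  rw [map_mul, h.map_base, one_mul] at h1
  refine mul_right_cancel (b := Function.surjInv h.surj (π c)) ?_
  rw [← h1, h.map_add, mul_assoc, ← hm c]

end IsPrimeExt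

namespace IsSplitting

variable {p : ℕ} {G Q : Type*} [Group G] [Group Q] {φ : ZMod p → G} {π : G →* Q}
  {χ : Q →* (ZMod p)ˣ} {m : G → ZMod p}

theorem map_base_mul (h : IsSplitting φ π χ m) (hE : IsPrimeExt φ π χ) (x : ZMod p) (c : G) :
    m (φ x * c) = x + m c := by
  rw [h.map_mul, h.map_base, hE.map_base]; simp

/-- A splitting is a coordinate along the kernel: together with the projection it identifies `G`
with `ℤ_p × Q`. -/
theorem bijective (h : IsSplitting φ π χ m) (hE : IsPrimeExt φ π χ) :
    Function.Bijective fun c => (m c, π c) := by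
  constructor
  · intro c d hcd
    simp only [Prod.mk.injEq] at hcd
    obtain ⟨x, rfl⟩ := hE.exists_of_eq hcd.2
    have := hcd.1
    rw [h.map_base_mul hE, add_eq_right] at this
    rw [this, hE.map_zero, one_mul]
  · rintro ⟨x, q⟩
    obtain ⟨c, rfl⟩ := hE.surj q
    refine ⟨φ (x - m c) * c, ?_⟩
    simp [h.map_base_mul hE, hE.map_base]

theorem eq_base_mul (h : IsSplitting φ π χ m) (hE : IsPrimeExt φ π χ) {c d : G}
    (hcd : π c = π d) : c = φ (m c - m d) * d := by
  obtain ⟨x, rfl⟩ := hE.exists_of_eq hcd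
  simp [h.map_base_mul hE]

end IsSplitting

/-! ### Orbit counting -/

section Orbits

/-- The number of orbits, in terms of stabilizers and of fixed points. -/
theorem card_orbits_eq_stabilizers {K X : Type*} [Group K] [Finite K] [Finite X] [MulAction K X] :
    (Nat.card (MulAction.orbitRel.Quotient K X) : ℚ) =
      1 / (Nat.card K : ℚ) * ∑ᶠ x : X, (Nat.card {g : K // g • x = x} : ℚ) ∧
    (Nat.card (MulAction.orbitRel.Quotient K X) : ℚ) =
      1 / (Nat.card K : ℚ) * ∑ᶠ g : K, (Nat.card {x : X // g • x = x} : ℚ) := by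
  classical
  have := Fintype.ofFinite K
  have := Fintype.ofFinite X
  have := Fintype.ofFinite (MulAction.orbitRel.Quotient K X)
  have hK : (Nat.card K : ℚ) ≠ 0 := by exact_mod_cast Nat.card_pos.ne'
  have h1 : ∑ g : K, Nat.card {x : X // g • x = x} =
      Nat.card (MulAction.orbitRel.Quotient K X) * Nat.card K := by
    have := MulAction.sum_card_fixedBy_eq_card_orbits_mul_card_group K X
    rw [Nat.card_eq_fintype_card, Nat.card_eq_fintype_card, ← this]
    refine Finset.sum_congr rfl fun g _ => ?_
    rw [Nat.card_eq_fintype_card]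
    rfl
  have h2 : ∑ x : X, Nat.card {g : K // g • x = x} = ∑ g : K, Nat.card {x : X // g • x = x} := by
    rw [← Nat.card_sigma, ← Nat.card_sigma]
    exact Nat.card_congr
      { toFun := fun a => ⟨a.2.1, a.1, a.2.2⟩
        invFun := fun a => ⟨a.2.1, a.1, a.2.2⟩
        left_inv := fun _ => rfl
        right_inv := fun _ => rfl }
  rw [finsum_eq_sum_of_fintype, finsum_eq_sum_of_fintype, ← Nat.cast_sum, ← Nat.cast_sum, h2, h1]
  push_cast
  constructor <;> field_simp

/-- If the fibres of `f` are the orbits, then the orbits correspond to the values of `f`. -/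
theorem card_orbits_eq_card_range {K X Y : Type*} [Group K] [MulAction K X] (f : X → Y)
    (hf : ∀ x y, f x = f y ↔ ∃ g : K, g • y = x) :
    Nat.card (MulAction.orbitRel.Quotient K X) = Nat.card (Set.range f) := by
  refine Nat.card_congr ((Quotient.congrRight fun x y => ?_).trans (Setoid.quotientKerEquivRange f))
  rw [Setoid.ker_def, hf]
  rfl

end Orbits

/-! ### Skew brace identities and the maps `λ_a` -/

namespace SkewBrace

section Basic

variable {B : Type*} [SkewBrace B]

theorem circ_mul (a b c : B) : circ a (b * c) = circ a b * a⁻¹ * circ a c := brace a b c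

theorem circ_assoc (a b c : B) : circ (circ a b) c = circ a (circ b c) :=
  mul_assoc (toCirc a) (toCirc b) (toCirc c)

theorem circ_one (a : B) : circ a 1 = a := by
  have h := circ_mul a 1 1
  rw [mul_one, mul_assoc, left_eq_mul] at h
  exact (inv_mul_eq_one.1 h).symm

theorem toCirc_one : (toCirc (1 : B)) = 1 :=
  mul_eq_left.1 (circ_one (1 : B) : toCirc (1 : B) * toCirc 1 = toCirc 1)

theorem one_circ (a : B) : circ 1 a = a := by
  change toCirc (1 : B) * toCirc a = toCirc a
  rw [toCirc_one, one_mul]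

theorem circ_left_cancel {a b c : B} (h : circ a b = circ a c) : b = c :=
  mul_left_cancel (a := toCirc a) h

theorem circ_right_cancel {a b c : B} (h : circ b a = circ c a) : b = c :=
  mul_right_cancel (b := toCirc a) h

theorem exists_circ_eq (a b : B) : ∃ c, circ a c = b := ⟨(toCirc a)⁻¹ * toCirc b,
  mul_inv_cancel_left (toCirc a) (toCirc b)⟩

/-- The map `λ_a : b ↦ a⁻¹ · (a ∘ b)`. -/
def lam (a b : B) : B := a⁻¹ * circ a b

theorem circ_eq (a b : B) : circ a b = a * lam a b := by simp [lam]

theorem lam_mul (a b c : B) : lam a (b * c) = lam a b * lam a c := by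
  simp [lam, circ_mul, mul_assoc]

theorem lam_circ (a b c : B) : lam (circ a b) c = lam a (lam b c) := by
  have h := lam_mul a b (lam b c)
  rw [← circ_eq] at h
  rw [← mul_right_inj (lam a b), ← h]
  simp [lam, circ_assoc, mul_assoc]

theorem one_lam (c : B) : lam 1 c = c := by simp [lam, one_circ]

theorem lam_one (a : B) : lam a 1 = 1 := by simp [lam, circ_one]

theorem lam_injective (a : B) : Function.Injective (lam a) := fun _ _ h =>
  circ_left_cancel (mul_left_cancel h)

theorem lam_surjective (a : B) : Function.Surjective (lam a) := fun b => by
  obtain ⟨c, hc⟩ := exists_circ_eq a (a * b)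
  exact ⟨c, by simp [lam, hc]⟩

theorem lam_pow (a b : B) (k : ℕ) : lam a (b ^ k) = lam a b ^ k := by
  induction k with
  | zero => simp [lam_one]
  | succ k ih => rw [pow_succ, lam_mul, ih, pow_succ]

end Basic

/-! ### Opposite skew braces, morphisms and extensions -/

section Opposite

variable {B : Type*} [SkewBrace B]

/-- The opposite skew brace, with the opposite additive group. -/
instance : SkewBrace Bᵐᵒᵖ where
  circGroup := ((MulOpposite.opEquiv (α := B)).symm.trans toCirc).group
  brace a b c := by
    apply MulOpposite.unop_injective
    change circ a.unop (c.unop * b.unop) =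
      circ a.unop c.unop * (a.unop⁻¹ * circ a.unop b.unop)
    rw [circ_mul, mul_assoc]

theorem circ_op (a b : Bᵐᵒᵖ) : circ a b = MulOpposite.op (circ a.unop b.unop) := rfl

end Opposite

/-- Morphisms of skew braces. -/
structure Hom (C B : Type*) [SkewBrace C] [SkewBrace B] extends C →* B where
  map_circ : ∀ a b : C, toFun (circ a b) = circ (toFun a) (toFun b)

namespace Hom

variable {C B B' : Type*} [SkewBrace C] [SkewBrace B] [SkewBrace B']

/-- The morphism of the multiplicative groups. -/
def circHom (π : Hom C B) : Circ C →* Circ B where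
  toFun a := toCirc (π.toFun (toCirc.symm a))
  map_one' := by
    change toCirc (π.toMonoidHom (toCirc.symm 1)) = 1
    rw [← toCirc_one, Equiv.symm_apply_apply, map_one, toCirc_one]
  map_mul' _ _ := π.map_circ _ _

/-- The morphism of the opposite skew braces. -/
def op (π : Hom C B) : Hom Cᵐᵒᵖ Bᵐᵒᵖ :=
  { MonoidHom.op π.toMonoidHom with
    map_circ := fun a b => congrArg MulOpposite.op (π.map_circ a.unop b.unop) }

end Hom

/-- An extension of a skew brace `B` by the trivial brace `ℤ_p`, with `B` acting on `ℤ_p` by `σ`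
in the additive and by `τ` in the multiplicative group. -/
structure IsBraceExt {p : ℕ} {C B : Type*} [SkewBrace C] [SkewBrace B] (φ : ZMod p → C)
    (π : Hom C B) (σ : B →* (ZMod p)ˣ) (τ : Circ B →* (ZMod p)ˣ) : Prop where
  dot : IsPrimeExt φ π.toMonoidHom σ
  circ : IsPrimeExt (fun x => toCirc (φ x)) π.circHom τ

/-- The character of the opposite additive group. -/
def opChar {B U : Type*} [Group B] [CommGroup U] (σ : B →* U) : Bᵐᵒᵖ →* U where
  toFun b := (σ b.unop)⁻¹
  map_one' := by simp
  map_mul' a b := by simp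

/-- The character of the multiplicative group of the opposite skew brace. -/
def opCircChar {B U : Type*} [SkewBrace B] [CommGroup U] (τ : Circ B →* U) : Circ Bᵐᵒᵖ →* U where
  toFun b := τ (toCirc (toCirc.symm b).unop)
  map_one' := τ.map_one
  map_mul' _ _ := τ.map_mul _ _

/-! ### Extensions of skew braces and simultaneous splittings -/

section Ext

variable {p : ℕ} {C B : Type*} [SkewBrace C] [SkewBrace B] {φ : ZMod p → C}
    {π : Hom C B} {σ : B →* (ZMod p)ˣ} {τ : Circ B →* (ZMod p)ˣ}

theorem map_lam (π : Hom C B) (a b : C) :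
    π.toMonoidHom (lam a b) = lam (π.toMonoidHom a) (π.toMonoidHom b) := by
  have := π.map_circ a b
  simp only [lam, map_mul, map_inv]
  exact congrArg _ this

/-- `λ_a` is an additive automorphism acting on the kernel by a nonzero scalar. Applying it to the
conjugation relation of `b` gives that of `λ_a(b)`, and the scalar cancels. -/
theorem char_lam (h : IsPrimeExt φ π.toMonoidHom σ) (a b : C) :
    σ (π.toMonoidHom (lam a b)) = σ (π.toMonoidHom b) := by
  have h1 : ∀ x, ∃ y, φ y = lam a (φ x) := fun x => (h.ker _).1 (by
    rw [map_lam, h.map_base, lam_one])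
  choose l hl using h1
  have hadd : ∀ x y, l (x + y) = l x + l y := fun x y => h.inj (by
    rw [hl, h.map_add, h.map_add, lam_mul, hl, hl])
  obtain ⟨d, hd⟩ := lam_surjective a (φ 1)
  obtain ⟨x, rfl⟩ := (h.ker d).1 (by
    apply lam_injective (π.toMonoidHom a)
    rw [← map_lam, hd, h.map_base, lam_one])
  have hx : l x = 1 := h.inj (by rw [hl, hd])
  have h2 := congrArg (lam a) (h.conj b x)
  rw [lam_mul, lam_mul, hd, h.conj, ← hl, mul_left_inj] at h2
  have h3 := h.inj h2
  rw [additive_eq_mul l hadd] at h3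
  rw [additive_eq_mul l hadd] at hx
  apply Units.ext
  linear_combination h3 + σ (π.toMonoidHom b) * hx

/-- Since `a ∘ b = a · λ_a(b)`, invariance of `σ` under `λ` turns additive into multiplicative
multiplicativity. -/
theorem mem_braceHom_of_ext (h : IsPrimeExt φ π.toMonoidHom σ) : σ ∈ braceHom B p := by
  intro a b
  obtain ⟨a, rfl⟩ := h.surj a
  obtain ⟨b, rfl⟩ := h.surj b
  rw [circ_eq, map_mul, ← map_lam, char_lam h]

theorem IsBraceExt.op (h : IsBraceExt φ π σ τ) :
    IsBraceExt (fun x => MulOpposite.op (φ x)) π.op (opChar σ) (opCircChar τ) where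
  dot :=
    { map_add := fun x y => by rw [add_comm, h.dot.map_add]; rfl
      inj := fun x y hxy => h.dot.inj (MulOpposite.op_injective hxy)
      surj := fun b => by
        obtain ⟨c, hc⟩ := h.dot.surj b.unop
        exact ⟨MulOpposite.op c, congrArg MulOpposite.op hc⟩
      ker := fun g => by
        rw [← MulOpposite.unop_inj]
        exact (h.dot.ker g.unop).trans (exists_congr fun x => MulOpposite.unop_inj)
      conj := fun g x => by
        apply MulOpposite.unop_injective
        change φ x * g.unop = g.unop * φ (((σ (π.toMonoidHom g.unop))⁻¹ : (ZMod p)ˣ) * x)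
        rw [h.dot.conj, ← mul_assoc, Units.mul_inv, one_mul] }
  circ :=
    { map_add := fun x y => congrArg MulOpposite.op (h.circ.map_add x y)
      inj := fun x y hxy => h.dot.inj (MulOpposite.op_injective hxy)
      surj := fun b => by
        obtain ⟨c, hc⟩ := h.dot.surj (toCirc.symm b).unop
        exact ⟨toCirc (MulOpposite.op c), congrArg MulOpposite.op hc⟩
      ker := fun g => by
        refine Iff.trans ?_ ((h.circ.ker (toCirc (toCirc.symm g).unop)).trans
          (exists_congr fun x => ?_))
        · exact MulOpposite.unop_inj.symm
        · exact MulOpposite.unop_inj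
      conj := fun g x => congrArg MulOpposite.op
        (h.circ.conj (toCirc (toCirc.symm g).unop) x) }

/-- For the converse one needs a single coordinate that is a crossed homomorphism for both
operations, with respect to `σ` and `τ`. It is the average over `(C, ∘)` of an additive splitting.
-/
theorem isDoubleSemidirect_iff [Finite B] (hB : IsUnit (Nat.card B : ZMod p)) :
    IsDoubleSemidirect C σ τ ↔ ∃ (φ : ZMod p → C) (π : Hom C B), IsBraceExt φ π σ τ ∧
      ∀ x c, circ (φ x) c = φ x * c := by
  constructor
  · rintro ⟨e, he, he'⟩
    let π : Hom C B := { MonoidHom.mk' (fun c => (e c).2) (fun x y => by rw [he]) with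
      map_circ := fun x y => by simp [he'] }
    have h1 : τ (toCirc 1) = 1 := by rw [toCirc_one, map_one]
    have hadd : ∀ x y, e.symm (x + y, 1) = e.symm (x, 1) * e.symm (y, 1) := fun x y =>
      e.injective (by rw [he]; simp)
    have hker : ∀ c, (e c).2 = 1 ↔ ∃ x, e.symm (x, 1) = c := fun c =>
      ⟨fun h => ⟨(e c).1, by rw [← h]; simp⟩, by rintro ⟨x, rfl⟩; simp⟩
    have hsurj : ∀ b, ∃ c, (e c).2 = b := fun b => ⟨e.symm (0, b), by simp⟩
    have hinj : ∀ x y : ZMod p, e.symm (x, 1) = e.symm (y, 1) → x = y := fun x y h =>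
      congrArg Prod.fst (e.symm.injective h)
    have hc : ∀ x c, circ (e.symm (x, 1)) c = e.symm (x, 1) * c := fun x c =>
      e.injective (by rw [he, he']; simp [h1, one_circ])
    have hcc : ∀ (c : C) x, circ c (e.symm (x, 1)) =
        circ (e.symm (τ (toCirc (e c).2) * x, 1)) c := fun c x =>
      e.injective (by rw [he', he']; simp [h1, one_circ, circ_one, add_comm])
    refine ⟨fun x => e.symm (x, 1), π, ⟨⟨hadd, hinj, hsurj, hker, ?_⟩, ⟨?_, hinj, hsurj, ?_, ?_⟩⟩,
      hc⟩
    · intro g x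
      apply e.injective
      rw [he, he]
      simp only [Equiv.apply_symm_apply, map_one, Units.val_one, one_mul, mul_one, Prod.mk.injEq,
        and_true]
      exact add_comm _ _
    · exact fun x y => (hadd x y).trans (hc x _).symm
    · intro g
      rw [← toCirc_one]
      exact hker g
    · exact fun g x => hcc g x
  · rintro ⟨φ, π, h, hφ⟩
    have := Fintype.ofFinite B
    have : Fintype (Circ B) := Fintype.ofFinite B
    have hB' : IsUnit (Nat.card (Circ B) : ZMod p) := hB
    obtain ⟨m₀, hm₀⟩ := h.dot.exists_splitting hB
    -- By `hφ`, translation by the kernel is the same for both operations, so `m₀` is also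
    -- equivariant for `∘`.
    have hs := h.circ.average_isSplitting hB' m₀ fun x c => by
      refine Eq.trans ?_ (hm₀.map_base_mul h.dot x c)
      exact congrArg m₀ (hφ x c)
    set m : C → ZMod p := h.circ.average m₀ with hm
    have hdot : ∀ c d, m (c * d) = m c + σ (π.toMonoidHom c) * m d := by
      intro c d
      refine h.circ.average_eq_add fun a => ?_
      -- The increment of `m₀` from `a` to `a ∘ b` is `σ(a) m₀(λ_a(b))`. As `λ_a` is additive and
      -- preserves `σ`, this is again a crossed homomorphism in `b`.
      have key : ∀ b : C, m₀ (a * toCirc b) =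
          m₀ a + σ (π.toMonoidHom (toCirc.symm a)) * m₀ (lam (toCirc.symm a) b) :=
        fun b => (congrArg m₀ (circ_eq (toCirc.symm a) b)).trans (hm₀.map_mul _ _)
      have k1 := key (c * d)
      rw [lam_mul, hm₀.map_mul, char_lam h.dot] at k1
      refine (congrArg (· - m₀ a) k1).trans (Eq.trans ?_ (congrArg₂ (fun u v => u - m₀ a +
        σ (π.toMonoidHom c) * (v - m₀ a)) (key c) (key d)).symm)
      ring
    have hm2 : IsSplitting φ π.toMonoidHom σ m := ⟨hdot, hs.map_base⟩
    refine ⟨Equiv.ofBijective _ (hm2.bijective h.dot), fun x y => ?_, fun x y => ?_⟩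
    · simp only [Equiv.ofBijective_apply, hdot, map_mul]
    · exact Prod.ext (hs.map_mul x y) (π.map_circ x y)

theorem isMirrorDoubleSemidirect_iff_op :
    IsMirrorDoubleSemidirect C σ τ ↔ IsDoubleSemidirect Cᵐᵒᵖ (opChar σ) (opCircChar τ) := by
  constructor
  · rintro ⟨e, he, he'⟩
    refine ⟨MulOpposite.opEquiv.symm.trans (e.trans ((Equiv.refl _).prodCongr MulOpposite.opEquiv)),
      fun x y => ?_, fun x y => ?_⟩
    · have := he y.unop x.unop
      simp [opChar, this, add_comm]
    · have := he' x.unop y.unop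
      simp [circ_op, this]
      rfl
  · rintro ⟨e, he, he'⟩
    refine ⟨MulOpposite.opEquiv.trans (e.trans ((Equiv.refl _).prodCongr MulOpposite.opEquiv.symm)),
      fun x y => ?_, fun x y => ?_⟩
    · have := he (MulOpposite.op y) (MulOpposite.op x)
      simp [opChar, this, add_comm]
    · have := he' (MulOpposite.op x) (MulOpposite.op y)
      simp only [circ_op, MulOpposite.unop_op] at this
      simp [this]
      rfl

/-- In the opposite additive group the condition `φ x ∘ c = c · φ x` becomes that of the direct
case, so the converse reduces to `isDoubleSemidirect_iff`. -/
theorem isMirrorDoubleSemidirect_iff [Finite B] (hB : IsUnit (Nat.card B : ZMod p)) :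
    IsMirrorDoubleSemidirect C σ τ ↔ ∃ (φ : ZMod p → C) (π : Hom C B), IsBraceExt φ π σ τ ∧
      ∀ x c, circ (φ x) c = c * φ x := by
  constructor
  · rintro ⟨e, he, he'⟩
    let π : Hom C B := { MonoidHom.mk' (fun c => (e c).2) (fun x y => by rw [he]) with
      map_circ := fun x y => by simp [he'] }
    have h1 : τ (toCirc 1) = 1 := by rw [toCirc_one, map_one]
    have hadd : ∀ x y, e.symm (x + y, 1) = e.symm (x, 1) * e.symm (y, 1) := fun x y =>
      e.injective (by rw [he]; simp)
    have hker : ∀ c, (e c).2 = 1 ↔ ∃ x, e.symm (x, 1) = c := fun c =>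
      ⟨fun h => ⟨(e c).1, by rw [← h]; simp⟩, by rintro ⟨x, rfl⟩; simp⟩
    have hsurj : ∀ b, ∃ c, (e c).2 = b := fun b => ⟨e.symm (0, b), by simp⟩
    have hinj : ∀ x y : ZMod p, e.symm (x, 1) = e.symm (y, 1) → x = y := fun x y h =>
      congrArg Prod.fst (e.symm.injective h)
    have hc : ∀ x c, circ (e.symm (x, 1)) c = c * e.symm (x, 1) := fun x c =>
      e.injective (by rw [he, he']; simp [h1, one_circ, add_comm])
    have hcc : ∀ (c : C) x, circ c (e.symm (x, 1)) =
        circ (e.symm (τ (toCirc (e c).2) * x, 1)) c := fun c x =>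
      e.injective (by rw [he', he']; simp [h1, one_circ, circ_one, add_comm])
    refine ⟨fun x => e.symm (x, 1), π, ⟨⟨hadd, hinj, hsurj, hker, ?_⟩, ⟨?_, hinj, hsurj, ?_, ?_⟩⟩,
      hc⟩
    · intro g x
      apply e.injective
      rw [he, he]
      simp only [Equiv.apply_symm_apply, map_one, Units.val_one, one_mul, mul_one, Prod.mk.injEq,
        and_true, inv_one]
      change _ = (((σ (e g).2)⁻¹ : (ZMod p)ˣ) : ZMod p) * ((σ (e g).2 : ZMod p) * x) + _
      rw [Units.inv_mul_cancel_left, add_comm]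
    · exact fun x y => ((congrArg (fun z => e.symm (z, (1 : B))) (add_comm x y)).trans (hadd y x)).trans
        (hc x _).symm
    · intro g
      rw [← toCirc_one]
      exact hker g
    · exact fun g x => hcc g x
  · rintro ⟨φ, π, h, hφ⟩
    have : Finite Bᵐᵒᵖ := Finite.of_equiv B MulOpposite.opEquiv
    have : Nat.card Bᵐᵒᵖ = Nat.card B := Nat.card_congr MulOpposite.opEquiv.symm
    rw [isMirrorDoubleSemidirect_iff_op, isDoubleSemidirect_iff (by rwa [this])]
    exact ⟨_, _, h.op, fun x c => congrArg MulOpposite.op (hφ x c.unop)⟩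

end Ext

end SkewBrace

/-! ### The ideal of order `p` -/

/-- Conjugation on the kernel is a character of `G`. It is trivial on elements of exponent `p`,
hence on the kernel, and descends to `Q`. -/
theorem isPrimeExt_of_ker {p : ℕ} (hp : p.Prime) {G Q : Type*} [Group G] [Group Q]
    {φ : ZMod p → G} {π : G →* Q} (hadd : ∀ x y, φ (x + y) = φ x * φ y)
    (hinj : Function.Injective φ) (hπ : Function.Surjective π)
    (hker : ∀ g, π g = 1 ↔ ∃ x, φ x = g) : ∃ χ, IsPrimeExt φ π χ := by
  have h : ∀ g x, ∃ y, φ y = g * φ x * g⁻¹ := fun g x => (hker _).1 (by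
    simp [(hker (φ x)).2 ⟨x, rfl⟩])
  choose act hact using h
  obtain ⟨χ, hχ⟩ := exists_units_hom_of_additive act
    (fun g x y => hinj (by rw [hact, hadd, hadd, hact, hact]; group))
    (fun g h x => hinj (by rw [hact, hact, hact]; group))
    (fun x => hinj (by rw [hact]; group))
  have h0 : φ 0 = 1 := by simpa using hadd 0 0
  have hpow : ∀ (x : ZMod p) (k : ℕ), φ x ^ k = φ (k * x) := by
    intro x k
    induction k with
    | zero => simp [h0]
    | succ k ih => rw [pow_succ, ih, ← hadd]; push_cast; ring_nf
  obtain ⟨χ', hχ'⟩ := exists_hom_factor π hπ χ fun g hg => by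
    obtain ⟨x, rfl⟩ := (hker g).1 hg
    exact units_hom_eq_one_of_pow hp χ (by rw [hpow]; simp [h0])
  exact ⟨χ', hadd, hinj, hπ, hker, fun g x => by rw [hχ', ← hχ, hact]; group⟩

/-- A normal subgroup of order `p` and index prime to `p` is a copy of `ℤ_p`, and consists of the
elements of exponent `p`. -/
theorem exists_base_of_normal {p n : ℕ} (hp : p.Prime) (hnp : ¬ p ∣ n) {G : Type*} [Group G]
    (hG : Nat.card G = n * p) (P : Subgroup G) [P.Normal] (hP : Nat.card P = p) :
    Nat.card (G ⧸ P) = n ∧ (∃ φ : ZMod p → G, (∀ x y, φ (x + y) = φ x * φ y) ∧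
      Function.Injective φ ∧ ∀ g, g ∈ P ↔ ∃ x, φ x = g) ∧ ∀ g, g ∈ P ↔ g ^ p = 1 := by
  have := Fact.mk hp
  have hQ : Nat.card (G ⧸ P) = n := by
    have := P.card_eq_card_quotient_mul_card_subgroup
    rw [hG, hP] at this
    exact (Nat.eq_of_mul_eq_mul_right hp.pos this).symm
  refine ⟨hQ, ?_, fun g => ⟨fun hg => ?_, fun hg => ?_⟩⟩
  · let E : Multiplicative (ZMod p) ≃* P := mulEquivOfPrimeCardEq (p := p)
      (by simp) hP
    refine ⟨fun x => E (Multiplicative.ofAdd x), fun x y => by simp, fun x y hxy => ?_, fun g => ?_⟩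
    · exact Multiplicative.ofAdd.injective (E.injective (Subtype.ext hxy))
    · constructor
      · intro hg
        exact ⟨(E.symm ⟨g, hg⟩).toAdd, by simp⟩
      · rintro ⟨x, rfl⟩
        exact (E _).2
  · have h : (⟨g, hg⟩ : P) ^ p = 1 := by rw [← hP]; exact pow_card_eq_one'
    exact congrArg Subtype.val h
  · rw [← QuotientGroup.eq_one_iff]
    -- The order of the image of `g` divides both `p` and `n`, so it is 1.
    have h2 : orderOf (g : G ⧸ P) ∣ p := orderOf_dvd_of_pow_eq_one (by
      rw [← QuotientGroup.mk_pow, hg, QuotientGroup.mk_one])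
    have h3 : orderOf (g : G ⧸ P) ∣ n := hQ ▸ orderOf_dvd_natCard _
    rcases (Nat.dvd_prime hp).1 h2 with h | h
    · exact orderOf_eq_one_iff.1 h
    · exact absurd (h ▸ h3) hnp

namespace SkewBrace

section Quotient

variable {C : Type*} [SkewBrace C]

/-- The two quotient sets of a skew brace by an ideal agree. -/
def quotientCircEquiv (P : Subgroup C) (Q : Subgroup (Circ C))
    (h : ∀ a b : C, a⁻¹ * b ∈ P ↔ (toCirc a)⁻¹ * toCirc b ∈ Q) : C ⧸ P ≃ Circ C ⧸ Q :=
  Quotient.congr (ra := QuotientGroup.leftRel P) (rb := QuotientGroup.leftRel Q)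
    toCirc (fun a b => by rw [QuotientGroup.leftRel_apply, QuotientGroup.leftRel_apply, h])

/-- The quotient of a skew brace by an ideal. -/
@[reducible]
def quotientBrace (P : Subgroup C) [P.Normal] (Q : Subgroup (Circ C)) [Q.Normal]
    (h : ∀ a b : C, a⁻¹ * b ∈ P ↔ (toCirc a)⁻¹ * toCirc b ∈ Q) : SkewBrace (C ⧸ P) where
  circGroup := (quotientCircEquiv P Q h).group
  brace a b c := by
    induction a using QuotientGroup.induction_on with | H a => ?_
    induction b using QuotientGroup.induction_on with | H b => ?_
    induction c using QuotientGroup.induction_on with | H c => ?_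
    exact congrArg (QuotientGroup.mk (s := P)) (circ_mul a b c)

end Quotient

/-- If the groups of order `np` have normal subgroups of order `p`, then a skew brace of size `np`
is an extension of a skew brace of size `n` by `ℤ_p`. -/
theorem exists_isBraceExt {n p : ℕ} (hp : p.Prime) (hnp : ¬ p ∣ n)
    (hG : ∀ (G : Type) [Group G], Nat.card G = n * p →
      ∃ P : Subgroup G, P.Normal ∧ Nat.card P = p) (C : FinSkewBrace (n * p)) :
    ∃ (B : FinSkewBrace n) (φ : ZMod p → C) (π : Hom C B) (σ : B →* (ZMod p)ˣ)
      (τ : Circ B →* (ZMod p)ˣ), IsBraceExt φ π σ τ := by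
  obtain ⟨P, hPn, hP⟩ := hG C C.card_eq
  obtain ⟨P', hPn', hP'⟩ := hG (Circ C) C.card_eq
  obtain ⟨hcard, ⟨φ, hadd, hinj, hφ⟩, hpow⟩ := exists_base_of_normal hp hnp C.card_eq P hP
  obtain ⟨-, -, hpow'⟩ := exists_base_of_normal (G := Circ C) hp hnp C.card_eq P' hP'
  -- `λ_a` is an additive automorphism, so it preserves the set of elements of exponent `p`.
  have hlam : ∀ a b : C, lam a b ∈ P ↔ b ∈ P := fun a b => by
    rw [hpow, hpow, ← lam_pow]
    exact ⟨fun h => lam_injective a (by rw [h, lam_one]), fun h => by rw [h, lam_one]⟩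
  let P₀ : Subgroup (Circ C) :=
    { carrier := {a | toCirc.symm a ∈ P}
      one_mem' := by
        change toCirc.symm 1 ∈ P
        rw [← toCirc_one]
        exact P.one_mem
      mul_mem' := fun {a b} ha hb => by
        change circ (toCirc.symm a) (toCirc.symm b) ∈ P
        rw [circ_eq]
        exact P.mul_mem ha ((hlam _ _).2 hb)
      inv_mem' := fun {a} ha => by
        have h : circ (toCirc.symm a) (toCirc.symm a⁻¹) = toCirc.symm 1 := mul_inv_cancel a
        rw [← toCirc_one, circ_eq, Equiv.symm_apply_apply] at h
        change toCirc.symm a⁻¹ ∈ P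
        rw [← hlam (toCirc.symm a), eq_inv_of_mul_eq_one_right h]
        exact P.inv_mem ha }
  have hP₀ : Nat.card P₀ = p := hP
  -- `P₀` has order `p`, so its elements have multiplicative exponent `p` and lie in `P'`; equality
  -- follows by cardinality.
  have hle : P₀ ≤ P' := fun a ha => (hpow' a).2 (by
    have h : (⟨a, ha⟩ : P₀) ^ p = 1 := orderOf_dvd_iff_pow_eq_one.1 (by
      conv_rhs => rw [← hP₀]
      exact orderOf_dvd_natCard _)
    exact congrArg Subtype.val h)
  have : Finite P' := Nat.finite_of_card_ne_zero (by rw [hP']; exact hp.ne_zero)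
  obtain rfl : P₀ = P' := Subgroup.eq_of_le_of_card_ge hle (by rw [hP₀, hP'])
  have hrel : ∀ a b : C, a⁻¹ * b ∈ P ↔ (toCirc a)⁻¹ * toCirc b ∈ P₀ := fun a b => by
    obtain ⟨c, rfl⟩ := exists_circ_eq a b
    change lam a c ∈ P ↔ (toCirc a)⁻¹ * (toCirc a * toCirc c) ∈ P₀
    rw [hlam, inv_mul_cancel_left]
    rfl
  let _ : SkewBrace (C ⧸ P) := quotientBrace P P₀ hrel
  let π : Hom C (C ⧸ P) := { QuotientGroup.mk' P with map_circ := fun _ _ => rfl }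
  have hsurj : Function.Surjective π.toMonoidHom := QuotientGroup.mk'_surjective P
  have hker : ∀ g, π.toMonoidHom g = 1 ↔ ∃ x, φ x = g := fun g =>
    (QuotientGroup.eq_one_iff g).trans (hφ g)
  obtain ⟨σ, hσ⟩ := isPrimeExt_of_ker hp hadd hinj hsurj hker
  have hmem : ∀ x, φ x ∈ P := fun x => (hφ _).2 ⟨x, rfl⟩
  -- `λ` acts on the kernel through a character of `(C, ∘)`. It is trivial on the kernel itself, so
  -- the two operations agree there and `φ` is also a homomorphism for `∘`.
  choose act hact using fun (c : Circ C) x => (hφ _).1 ((hlam (toCirc.symm c) _).2 (hmem x))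
  obtain ⟨l, hl⟩ := exists_units_hom_of_additive act
    (fun c x y => hinj (by rw [hact, hadd, hadd, hact, hact, lam_mul]))
    (fun c d x => hinj (by rw [hact, hact, hact]; exact lam_circ _ _ _))
    (fun x => hinj (by rw [hact, ← toCirc_one]; exact one_lam _))
  have hl1 : ∀ x, l (toCirc (φ x)) = 1 := fun x =>
    units_hom_eq_one_of_pow hp l ((hpow' _).1 (hmem x))
  have hadd' : ∀ x y, toCirc (φ (x + y)) = toCirc (φ x) * toCirc (φ y) := fun x y => by
    rw [← toCirc_circ, circ_eq, hadd]
    have := hact (toCirc (φ x)) y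
    rw [hl, hl1, Units.val_one, one_mul] at this
    exact congrArg (fun z => toCirc (φ x * z)) this
  have hker' : ∀ g, π.circHom g = 1 ↔ ∃ x, toCirc (φ x) = g := fun g => by
    rw [← toCirc_one]
    exact hker g
  obtain ⟨τ, hτ⟩ := isPrimeExt_of_ker (φ := fun x => toCirc (φ x)) (π := π.circHom) hp hadd' hinj
    hsurj hker'
  exact ⟨⟨C ⧸ P, hcard⟩, φ, π, σ, τ, hσ, hτ⟩

/-! ### The dichotomy between direct and mirror type -/

section Kind

variable {p : ℕ} {C B : Type*} [SkewBrace C] [SkewBrace B] {φ : ZMod p → C}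
    {π : Hom C B} {σ : B →* (ZMod p)ˣ} {τ : Circ B →* (ZMod p)ˣ}

/-- Left multiplication by the kernel is either the additive one or its mirror image. -/
theorem IsBraceExt.circ_base_eq [Finite B] (hp : p.Prime) (hB : IsUnit (Nat.card B : ZMod p))
    (h : IsBraceExt φ π σ τ) :
    (∀ x c, SkewBrace.circ (φ x) c = φ x * c) ∨ ∀ x c, SkewBrace.circ (φ x) c = c * φ x := by
  have := Fact.mk hp
  have := Fintype.ofFinite B
  obtain ⟨m, hm⟩ := h.dot.exists_splitting hB
  have hbase : ∀ x y, lam (φ x) (φ y) = φ y := fun x y => by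
    have h1 : φ (x + y) = SkewBrace.circ (φ x) (φ y) := h.circ.map_add x y
    rwa [h.dot.map_add, circ_eq, mul_right_inj, eq_comm] at h1
  have hπ : ∀ x c, π.toMonoidHom (lam (φ x) c) = π.toMonoidHom c := fun x c => by
    rw [map_lam, h.dot.map_base, one_lam]
  -- `λ_{φ x}` fixes the kernel pointwise, so the shift it causes depends only on the class of `c`
  -- in `B`.
  have hD : ∀ x c d, π.toMonoidHom c = π.toMonoidHom d →
      m (lam (φ x) c) - m c = m (lam (φ x) d) - m d := by
    intro x c d hcd
    obtain ⟨y, rfl⟩ := h.dot.exists_of_eq hcd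
    rw [lam_mul, hbase, hm.map_base_mul h.dot, hm.map_base_mul h.dot]
    ring
  let s := Function.surjInv h.dot.surj
  have hs : ∀ b, π.toMonoidHom (s b) = b := Function.surjInv_eq h.dot.surj
  let D : ZMod p → B → ZMod p := fun x b => m (lam (φ x) (s b)) - m (s b)
  have hDπ : ∀ x c, m (lam (φ x) c) - m c = D x (π.toMonoidHom c) := fun x c =>
    hD x c _ (hs _).symm
  have hDmul : ∀ x b c, D x (b * c) = D x b + σ b * D x c := by
    intro x b c
    have h1 := hDπ x (s b * s c)
    rw [map_mul, hs, hs] at h1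
    rw [← h1, lam_mul, hm.map_mul, hm.map_mul, hπ, hs]
    simp only [D]
    ring
  have hDadd : ∀ x y b, D (x + y) b = D x b + D y b := by
    intro x y b
    have h1 : φ (x + y) = SkewBrace.circ (φ x) (φ y) := h.circ.map_add x y
    have h2 := hDπ x (lam (φ y) (s b))
    rw [hπ, hs] at h2
    rw [← h2]
    simp only [D]
    rw [h1, lam_circ]
    ring
  -- The constant trivializing the crossed homomorphism `D x`. It is linear in `x`, so `κ 1` is the
  -- number `k` on which everything depends.
  let κ : ZMod p → ZMod p := fun x => (Nat.card B : ZMod p)⁻¹ * ∑ r, D x r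
  have hκ : ∀ x, κ x = κ 1 * x := additive_eq_mul κ fun x y => by
    simp only [κ, hDadd, Finset.sum_add_distrib, mul_add]
  have hDκ : ∀ x b, D x b = (1 - σ b) * κ x := fun x => crossed_hom_principal hB σ _ (hDmul x)
  have hcirc : ∀ x c, SkewBrace.circ (φ x) c =
      φ ((1 + κ 1 * (1 - σ (π.toMonoidHom c))) * x) * c := by
    intro x c
    rw [circ_eq, hm.eq_base_mul h.dot (hπ x c), hDπ, hDκ, hκ, ← mul_assoc, ← h.dot.map_add]
    ring_nf
  by_cases hσ : ∀ c, σ (π.toMonoidHom c) = 1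
  · left
    intro x c
    rw [hcirc, hσ]
    simp
  push Not at hσ
  obtain ⟨c, hc⟩ := hσ
  choose act hact using fun (c : C) x => (h.dot.ker (lam c (φ x))).1 (by
    rw [map_lam, h.dot.map_base, lam_one])
  have hL : ∀ c x, act c x = act c 1 * x := fun c => additive_eq_mul (act c) fun x y =>
    h.dot.inj (by rw [hact, h.dot.map_add, h.dot.map_add, lam_mul, hact, hact])
  have hLL : act (SkewBrace.circ c c) 1 = act c 1 * act c 1 := by
    rw [← hL]
    exact h.dot.inj (by rw [hact, hact, hact, lam_circ])
  -- Write `c ∘ φ 1` in two ways: through `λ_c` and additive conjugation, and through multiplicative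
  -- conjugation and `hcirc`.
  have hrel : ∀ c : C, (σ (π.toMonoidHom c) : ZMod p) * act c 1 =
      (1 + κ 1 * (1 - σ (π.toMonoidHom c))) * τ (π.circHom (toCirc c)) := by
    intro c
    have h1 : SkewBrace.circ c (φ 1) =
      SkewBrace.circ (φ (τ (π.circHom (toCirc c)) * 1)) c := h.circ.conj (toCirc c) 1
    rw [circ_eq, ← hact, h.dot.conj, hcirc, mul_left_inj] at h1
    rw [h.dot.inj h1, mul_one]
  have hσσ : σ (π.toMonoidHom (SkewBrace.circ c c)) =
      σ (π.toMonoidHom c) * σ (π.toMonoidHom c) := by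
    rw [← mem_braceHom_of_ext h.dot]
    exact congrArg σ (π.map_circ c c)
  have hττ : τ (π.circHom (toCirc (SkewBrace.circ c c))) =
      τ (π.circHom (toCirc c)) * τ (π.circHom (toCirc c)) := by
    rw [← map_mul, ← map_mul]
    rfl
  -- All three of `σ`, `τ` and the scalar of `λ` are squared in passing from `c` to `c ∘ c`, whereas
  -- the factor `1 + k (1 - σ)` is not squared in general. Comparison gives `k (1 + k) (1 - u)² t² =
  -- 0` with `u = σ(c) ≠ 1` and `t = τ(c)`.
  have h1 := hrel c
  have h2 := hrel (SkewBrace.circ c c)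
  rw [hσσ, hττ, hLL, Units.val_mul, Units.val_mul] at h2
  have ht := (τ (π.circHom (toCirc c))).ne_zero
  have hs1 : (1 - (σ (π.toMonoidHom c) : ZMod p)) ≠ 0 := fun h0 =>
    hc (Units.ext (by rw [Units.val_one]; linear_combination -h0))
  generalize (σ (π.toMonoidHom c) : ZMod p) = u at *
  generalize (τ (π.circHom (toCirc c)) : ZMod p) = t at *
  generalize κ 1 = k at *
  generalize act c 1 = l at *
  have h3 : (k * (1 + k)) * ((1 - u) * (t * t) * (1 - u)) = 0 := by
    linear_combination h2 - (u * l + (1 + k * (1 - u)) * t) * h1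
  have h4 : (1 - u) * (t * t) * (1 - u) ≠ 0 :=
    mul_ne_zero (mul_ne_zero hs1 (mul_ne_zero ht ht)) hs1
  rcases mul_eq_zero.1 ((mul_eq_zero.1 h3).resolve_right h4) with h5 | h5
  · left
    intro x d
    rw [hcirc, h5]
    simp
  · right
    -- For `k = -1` the factor `1 + k (1 - σ(d))` is `σ(d)`, and `φ(σ(d) x) · d = d · φ(x)`.
    intro x d
    rw [hcirc, h.dot.conj]
    congr 2
    linear_combination (1 - (σ (π.toMonoidHom d) : ZMod p)) * x * h5

end Kind

/-! ### Construction of the products -/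

section Product

variable {p : ℕ} {B : Type*} [SkewBrace B]

/-- The double semidirect product of `ℤ_p` and `B` via `σ` and `τ`. -/
@[ext]
structure DoubleProduct {σ : B →* (ZMod p)ˣ} (hσ : σ ∈ braceHom B p)
    (τ : Circ B →* (ZMod p)ˣ) where
  base : ZMod p
  top : B

variable {σ : B →* (ZMod p)ˣ} {hσ : σ ∈ braceHom B p} {τ : Circ B →* (ZMod p)ˣ}

instance : Mul (DoubleProduct hσ τ) := ⟨fun x y => ⟨x.base + σ x.top * y.base, x.top * y.top⟩⟩
instance : One (DoubleProduct hσ τ) := ⟨⟨0, 1⟩⟩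
instance : Inv (DoubleProduct hσ τ) := ⟨fun x => ⟨-((σ x.top)⁻¹ : (ZMod p)ˣ) * x.base, x.top⁻¹⟩⟩

theorem DoubleProduct.mul_def (x y : DoubleProduct hσ τ) :
    x * y = ⟨x.base + σ x.top * y.base, x.top * y.top⟩ := rfl

theorem DoubleProduct.one_def : (1 : DoubleProduct hσ τ) = ⟨0, 1⟩ := rfl

theorem DoubleProduct.inv_def (x : DoubleProduct hσ τ) :
    x⁻¹ = ⟨-((σ x.top)⁻¹ : (ZMod p)ˣ) * x.base, x.top⁻¹⟩ := rfl

instance : Group (DoubleProduct hσ τ) := Group.ofLeftAxioms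
  (fun x y z => by simp [DoubleProduct.mul_def, mul_add, add_assoc, mul_assoc])
  (fun x => by simp [DoubleProduct.mul_def, DoubleProduct.one_def])
  (fun x => by simp [DoubleProduct.mul_def, DoubleProduct.one_def, DoubleProduct.inv_def])

instance : Mul (Circ (DoubleProduct hσ τ)) := ⟨fun x y => toCirc
  ⟨(toCirc.symm x).base + τ (toCirc (toCirc.symm x).top) * (toCirc.symm y).base,
    circ (toCirc.symm x).top (toCirc.symm y).top⟩⟩

instance : Group (Circ (DoubleProduct hσ τ)) :=
  @Group.ofLeftAxioms _ _ ⟨fun x => toCirc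
    ⟨-((τ (toCirc (toCirc.symm x).top))⁻¹ : (ZMod p)ˣ) * (toCirc.symm x).base,
      toCirc.symm (toCirc (toCirc.symm x).top)⁻¹⟩⟩ ⟨toCirc ⟨0, 1⟩⟩
  (fun x y z => by
    refine DoubleProduct.ext ?_ (circ_assoc _ _ _)
    change (_ + _ * _) + ((τ (toCirc _ * toCirc _) : (ZMod p)ˣ) : ZMod p) * _ = _ + _ * (_ + _ * _)
    rw [map_mul, Units.val_mul]
    ring)
  (fun x => by
    refine DoubleProduct.ext ?_ (one_circ _)
    change 0 + ((τ (toCirc 1) : (ZMod p)ˣ) : ZMod p) * _ = _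
    rw [toCirc_one, map_one, Units.val_one, one_mul, zero_add]
    rfl)
  (fun x => by
    refine DoubleProduct.ext ?_ ?_
    · change -((τ (toCirc (toCirc.symm x).top))⁻¹ : (ZMod p)ˣ) * (toCirc.symm x).base +
        ((τ (toCirc (toCirc.symm x).top)⁻¹ : (ZMod p)ˣ) : ZMod p) * (toCirc.symm x).base = 0
      rw [map_inv]
      ring
    · exact (inv_mul_cancel (toCirc (toCirc.symm x).top)).trans toCirc_one.symm)

instance : SkewBrace (DoubleProduct hσ τ) where
  circGroup := (inferInstance : Group (Circ (DoubleProduct hσ τ)))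
  brace a b c := by
    refine DoubleProduct.ext ?_ (circ_mul _ _ _)
    change a.base + τ (toCirc a.top) * (b.base + σ b.top * c.base) =
      (a.base + τ (toCirc a.top) * b.base) + σ (circ a.top b.top) *
        (-((σ a.top)⁻¹ : (ZMod p)ˣ) * a.base) +
        σ (circ a.top b.top * a.top⁻¹) * (a.base + τ (toCirc a.top) * c.base)
    -- Here the compatibility of `σ` with `∘` enters: `σ(a ∘ b) σ(a)⁻¹ = σ(b)`.
    rw [map_mul, hσ, map_inv, Units.val_mul, Units.val_mul, Units.val_mul]
    have := (σ a.top).mul_inv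
    linear_combination (-(σ b.top * τ (toCirc a.top) * c.base) : ZMod p) * this

/-- The double semidirect product as a set of pairs. -/
def DoubleProduct.equiv (hσ : σ ∈ braceHom B p) (τ : Circ B →* (ZMod p)ˣ) :
    DoubleProduct hσ τ ≃ ZMod p × B where
  toFun x := (x.base, x.top)
  invFun x := ⟨x.1, x.2⟩

theorem isDoubleSemidirect_doubleProduct (hσ : σ ∈ braceHom B p) (τ : Circ B →* (ZMod p)ˣ) :
    IsDoubleSemidirect (DoubleProduct hσ τ) σ τ :=
  ⟨DoubleProduct.equiv hσ τ, fun _ _ => rfl, fun _ _ => rfl⟩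

theorem opChar_mem_braceHom (hσ : σ ∈ braceHom B p) : opChar σ ∈ braceHom Bᵐᵒᵖ p := fun a b => by
  change (σ (circ a.unop b.unop))⁻¹ = (σ a.unop)⁻¹ * (σ b.unop)⁻¹
  rw [hσ, mul_inv]

/-- The opposite of a double product over the opposite of `B`, so the brace axiom need not be
verified again. -/
theorem isMirrorDoubleSemidirect_doubleProduct (hσ : σ ∈ braceHom B p)
    (τ : Circ B →* (ZMod p)ˣ) :
    IsMirrorDoubleSemidirect (DoubleProduct (opChar_mem_braceHom hσ) (opCircChar τ))ᵐᵒᵖ σ τ :=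
  ⟨MulOpposite.opEquiv.symm.trans ((DoubleProduct.equiv _ _).trans
      ((Equiv.refl _).prodCongr MulOpposite.opEquiv.symm)),
    fun _ _ => Prod.ext (add_comm _ _) rfl, fun _ _ => rfl⟩

theorem exists_isDoubleSemidirect {n : ℕ} (hp : p ≠ 0) (B : FinSkewBrace n)
    {σ : B →* (ZMod p)ˣ} (hσ : σ ∈ braceHom B p) (τ : Circ B →* (ZMod p)ˣ) :
    ∃ C : FinSkewBrace (n * p), IsDoubleSemidirect C σ τ := by
  have := NeZero.mk hp
  exact ⟨@FinSkewBrace.mk _ (DoubleProduct hσ τ) _ (Finite.of_equiv _ (DoubleProduct.equiv hσ τ).symm)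
    (by rw [Nat.card_congr (DoubleProduct.equiv hσ τ), Nat.card_prod, Nat.card_zmod, B.card_eq,
      mul_comm]), isDoubleSemidirect_doubleProduct hσ τ⟩

theorem exists_isMirrorDoubleSemidirect {n : ℕ} (hp : p ≠ 0) (B : FinSkewBrace n)
    {σ : B →* (ZMod p)ˣ} (hσ : σ ∈ braceHom B p) (τ : Circ B →* (ZMod p)ˣ) :
    ∃ C : FinSkewBrace (n * p), IsMirrorDoubleSemidirect C σ τ := by
  have := NeZero.mk hp
  obtain ⟨e, he⟩ := isMirrorDoubleSemidirect_doubleProduct hσ τ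
  exact ⟨@FinSkewBrace.mk _ (DoubleProduct (opChar_mem_braceHom hσ) (opCircChar τ))ᵐᵒᵖ _
    (Finite.of_equiv _ e.symm)
    (by rw [Nat.card_congr e, Nat.card_prod, Nat.card_zmod, B.card_eq, mul_comm]), e, he⟩

end Product

end SkewBrace

namespace SkewBrace

/-! ### Isomorphisms of extensions and of products -/

section Iso

variable {p : ℕ} {C C' B B' : Type*} [SkewBrace C] [SkewBrace C'] [SkewBrace B] [SkewBrace B']
  {φ : ZMod p → C} {π : Hom C B} {σ : B →* (ZMod p)ˣ} {τ : Circ B →* (ZMod p)ˣ}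
  {φ' : ZMod p → C'} {π' : Hom C' B'} {σ' : B' →* (ZMod p)ˣ} {τ' : Circ B' →* (ZMod p)ˣ}

/-- An isomorphism of extensions induces an isomorphism of the quotients, and acts on the kernels
by a unit. -/
theorem exists_quotient_iso [Finite B] [Finite B'] (hB : (Nat.card B).Coprime p)
    (hB' : (Nat.card B').Coprime p) (h : IsPrimeExt φ π.toMonoidHom σ)
    (h' : IsPrimeExt φ' π'.toMonoidHom σ') (f : Iso C C') :
    ∃ (g : Iso B B') (u : (ZMod p)ˣ),
      (∀ c, π'.toMonoidHom (f.toMulEquiv c) = g.toMulEquiv (π.toMonoidHom c)) ∧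
      (∀ x, f.toMulEquiv (φ x) = φ' (u * x)) ∧ ∀ b, σ' (g.toMulEquiv b) = σ b := by
  -- Both kernels consist of the elements of exponent `p`, a condition that `f` preserves.
  have hker : ∀ c, π.toMonoidHom c = 1 ↔ π'.toMonoidHom (f.toMulEquiv c) = 1 := fun c => by
    rw [h.ker_iff_pow hB, h'.ker_iff_pow hB', ← map_pow, map_eq_one_iff _ f.toMulEquiv.injective]
  obtain ⟨g, hg⟩ := exists_hom_factor π.toMonoidHom h.surj
    (π'.toMonoidHom.comp f.toMulEquiv.toMonoidHom) fun c hc => (hker c).1 hc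
  have hg' : ∀ c, π'.toMonoidHom (f.toMulEquiv c) = g (π.toMonoidHom c) := fun c => (hg c).symm
  have hgb : Function.Bijective g := by
    constructor
    · rw [injective_iff_map_eq_one]
      intro b hb
      obtain ⟨c, rfl⟩ := h.surj b
      rwa [hker, hg']
    · intro b
      obtain ⟨c, rfl⟩ := h'.surj b
      refine ⟨π.toMonoidHom (f.toMulEquiv.symm c), ?_⟩
      rw [← hg', MulEquiv.apply_symm_apply]
  choose v hv using fun x => (h'.ker (f.toMulEquiv (φ x))).1 ((hker _).1 (h.map_base x))
  have hvadd : ∀ x y, v (x + y) = v x + v y := fun x y => h'.inj (by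
    rw [hv, h.map_add, map_mul, h'.map_add, hv, hv])
  obtain ⟨y, hy⟩ := (h.ker (f.toMulEquiv.symm (φ' 1))).1 (by
    rw [hker, MulEquiv.apply_symm_apply, h'.map_base])
  have hvy : v y = 1 := h'.inj (by rw [hv, hy, MulEquiv.apply_symm_apply])
  rw [additive_eq_mul v hvadd] at hvy
  let u : (ZMod p)ˣ := Units.mkOfMulEqOne _ _ hvy
  have hu : ∀ x, f.toMulEquiv (φ x) = φ' (u * x) := fun x => by
    rw [← hv, additive_eq_mul v hvadd]
    rfl
  refine ⟨{ MulEquiv.ofBijective g hgb with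
    map_circ := fun a b => ?_ }, u, hg', hu, fun b => ?_⟩
  · obtain ⟨a, rfl⟩ := h.surj a
    obtain ⟨b, rfl⟩ := h.surj b
    have h1 := hg' (circ a b)
    have h2 := π'.map_circ (f.toMulEquiv a) (f.toMulEquiv b)
    have h3 := f.map_circ a b
    change g (circ (π.toMonoidHom a) (π.toMonoidHom b)) =
      circ (g (π.toMonoidHom a)) (g (π.toMonoidHom b))
    rw [← hg', ← hg']
    refine Eq.trans ?_ h2
    refine Eq.trans ?_ (congrArg π'.toMonoidHom h3)
    exact (congrArg g (π.map_circ a b)).symm.trans h1.symm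
  · obtain ⟨c, rfl⟩ := h.surj b
    change σ' (g (π.toMonoidHom c)) = _
    have h1 := congrArg f.toMulEquiv (h.conj c 1)
    rw [map_mul, map_mul, hu, hu, h'.conj, hg', mul_left_inj] at h1
    have h2 := h'.inj h1
    apply Units.ext
    have := u.mul_inv
    linear_combination ((u⁻¹ : (ZMod p)ˣ) : ZMod p) * h2 +
      ((σ (π.toMonoidHom c) : ZMod p) - σ' (g (π.toMonoidHom c))) * this

/-- The isomorphism rescales the kernel by a unit, which cancels in the conjugation relations
because `ℤ_p` is commutative. -/
theorem exists_base_iso [Finite B] [Finite B'] (hB : (Nat.card B).Coprime p)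
    (hB' : (Nat.card B').Coprime p) (h : IsBraceExt φ π σ τ) (h' : IsBraceExt φ' π' σ' τ')
    (f : Iso C C') :
    ∃ g : Iso B B', (∀ b, σ' (g.toMulEquiv b) = σ b) ∧
      ∀ b, τ' (toCirc (g.toMulEquiv b)) = τ (toCirc b) := by
  obtain ⟨g, u, hg, hu, hσ⟩ := exists_quotient_iso hB hB' h.dot h'.dot f
  refine ⟨g, hσ, fun b => ?_⟩
  obtain ⟨c, rfl⟩ := h.dot.surj b
  have h1 : circ c (φ 1) = circ (φ (τ (toCirc (π.toMonoidHom c)) * 1)) c := h.circ.conj (toCirc c) 1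
  have h2 : circ (f.toMulEquiv c) (φ' (u * 1)) =
      circ (φ' (τ' (toCirc (π'.toMonoidHom (f.toMulEquiv c))) * (u * 1))) (f.toMulEquiv c) :=
    h'.circ.conj (toCirc (f.toMulEquiv c)) (u * 1)
  have hf : ∀ a b, f.toMulEquiv (circ a b) = circ (f.toMulEquiv a) (f.toMulEquiv b) := f.map_circ
  have h3 := congrArg f.toMulEquiv h1
  rw [hf, hf, hu, hu, h2, hg] at h3
  have h4 := h'.dot.inj (circ_right_cancel h3)
  apply Units.ext
  have := u.mul_inv
  linear_combination ((u⁻¹ : (ZMod p)ˣ) : ZMod p) * h4 +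
      ((τ (toCirc (π.toMonoidHom c)) : ZMod p) -
        τ' (toCirc (g.toMulEquiv (π.toMonoidHom c)))) * this

/-- Only for `σ = 1` an extension is both of the direct and of the mirror type. -/
theorem char_eq_one_of_both [Finite B] [Finite B'] (hB : (Nat.card B).Coprime p)
    (hB' : (Nat.card B').Coprime p) {ψ : ZMod p → C} {ρ : Hom C B'}
    (h : IsBraceExt φ π σ τ) (h' : IsBraceExt ψ ρ σ' τ')
    (hφ : ∀ x c, circ (φ x) c = φ x * c) (hψ : ∀ x c, circ (ψ x) c = c * ψ x) : σ' = 1 := by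
  -- The two kernels coincide, so `ψ 1` satisfies both conditions and commutes additively with every
  -- `c`.
  obtain ⟨x, hx⟩ := (h.dot.ker (ψ 1)).1 (by
    rw [h.dot.ker_iff_pow hB, ← h'.dot.ker_iff_pow hB', h'.dot.map_base])
  ext b
  obtain ⟨c, rfl⟩ := h'.dot.surj b
  have h1 := hψ 1 c
  rw [← hx, hφ, hx, h'.dot.conj, mul_left_inj] at h1
  simpa using (h'.dot.inj h1).symm

/-- The composite of a morphism and an isomorphism. -/
def Hom.compIso (π : Hom C B) (g : Iso B B') : Hom C B' :=
  { g.toMulEquiv.toMonoidHom.comp π.toMonoidHom with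
    map_circ := fun a b => (congrArg g.toFun (π.map_circ a b)).trans (g.map_circ _ _) }

theorem isPrimeExt_comp_mulEquiv {G Q Q' : Type*} [Group G] [Group Q] [Group Q'] {φ : ZMod p → G}
    {π : G →* Q} {χ : Q →* (ZMod p)ˣ} (h : IsPrimeExt φ π χ) {π' : G →* Q'} (g : Q ≃* Q')
    (hπ' : ∀ c, π' c = g (π c)) {χ' : Q' →* (ZMod p)ˣ} (hχ : ∀ q, χ' (g q) = χ q) :
    IsPrimeExt φ π' χ' where
  map_add := h.map_add
  inj := h.inj
  surj q := by
    obtain ⟨c, hc⟩ := h.surj (g.symm q)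
    exact ⟨c, by rw [hπ', hc, g.apply_symm_apply]⟩
  ker c := by rw [hπ', map_eq_one_iff _ g.injective, h.ker]
  conj c x := by rw [hπ', hχ, h.conj]

/-- The isomorphism of the multiplicative groups. -/
def Iso.circEquiv (g : Iso B B') : Circ B ≃* Circ B' where
  toEquiv := g.toEquiv
  map_mul' := g.map_circ

theorem IsBraceExt.compIso (h : IsBraceExt φ π σ τ) (g : Iso B B')
    (hσ : ∀ b, σ' (g.toMulEquiv b) = σ b) (hτ : ∀ b, τ' (g.circEquiv b) = τ b) :
    IsBraceExt φ (π.compIso g) σ' τ' :=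
  ⟨isPrimeExt_comp_mulEquiv h.dot g.toMulEquiv (fun _ => rfl) hσ,
    isPrimeExt_comp_mulEquiv h.circ g.circEquiv (fun _ => rfl) hτ⟩

end Iso

section Product

variable {p : ℕ} {B : Type*} [SkewBrace B]

/-- The two kinds of double semidirect products. -/
def IsProduct (mirror : Bool) (C : Type*) [SkewBrace C] (σ : B →* (ZMod p)ˣ)
    (τ : Circ B →* (ZMod p)ˣ) : Prop :=
  cond mirror (IsMirrorDoubleSemidirect C σ τ) (IsDoubleSemidirect C σ τ)

variable {C C' : Type*} [SkewBrace C] [SkewBrace C'] {k : Bool}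
  {σ σ' : B →* (ZMod p)ˣ} {τ τ' : Circ B →* (ZMod p)ˣ}

theorem IsProduct.exists_ext [Finite B] (hB : IsUnit (Nat.card B : ZMod p))
    (h : IsProduct k C σ τ) : ∃ (φ : ZMod p → C) (π : Hom C B), IsBraceExt φ π σ τ := by
  cases k
  · obtain ⟨φ, π, h, -⟩ := (isDoubleSemidirect_iff hB).1 h
    exact ⟨φ, π, h⟩
  · obtain ⟨φ, π, h, -⟩ := (isMirrorDoubleSemidirect_iff hB).1 h
    exact ⟨φ, π, h⟩

theorem IsProduct.of_iso (h : IsProduct k C σ τ) (f : Iso C C') : IsProduct k C' σ τ := by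
  have h1 : ∀ x y, f.symm.toMulEquiv (circ x y) =
    circ (f.symm.toMulEquiv x) (f.symm.toMulEquiv y) := f.symm.map_circ
  cases k <;>
  · obtain ⟨e, he, he'⟩ := h
    exact ⟨f.symm.toMulEquiv.toEquiv.trans e,
      fun x y => (congrArg e (map_mul f.symm.toMulEquiv x y)).trans (he _ _),
      fun x y => (congrArg e (h1 x y)).trans (he' _ _)⟩

/-- The map `id × g` on `ℤ_p × B` respects both operations when `g` carries the characters into each
other. -/
theorem IsProduct.nonempty_iso (h : IsProduct k C σ τ) (h' : IsProduct k C' σ' τ') (g : Iso B B)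
    (hσ : ∀ b, σ' (g.toMulEquiv b) = σ b) (hτ : ∀ b, τ' (toCirc (g.toMulEquiv b)) = τ (toCirc b)) :
    Nonempty (Iso C C') := by
  have hg : ∀ x y, g.toMulEquiv (circ x y) =
    circ (g.toMulEquiv x) (g.toMulEquiv y) := g.map_circ
  cases k <;>
  · obtain ⟨e, he, he'⟩ := h
    obtain ⟨d, hd, hd'⟩ := h'
    refine ⟨{ MulEquiv.mk (e.trans (((Equiv.refl _).prodCongr g.toMulEquiv.toEquiv).trans d.symm))
      (fun x y => d.injective ?_) with map_circ := fun x y => d.injective ?_ }⟩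
    · rw [hd]
      simp [he, hσ]
    · refine Eq.trans ?_ (hd' _ _).symm
      simp [he', hτ, hg]

theorem exists_isProduct {n : ℕ} (k : Bool) (hp : p ≠ 0) (B : FinSkewBrace n)
    {σ : B →* (ZMod p)ˣ} (hσ : σ ∈ braceHom B p) (τ : Circ B →* (ZMod p)ˣ) :
    ∃ C : FinSkewBrace (n * p), IsProduct k C σ τ := by
  cases k
  · exact exists_isDoubleSemidirect hp B hσ τ
  · exact exists_isMirrorDoubleSemidirect hp B hσ τ

end Product

/-! ### Actions of automorphism groups on characters -/

section Actions

variable {p : ℕ} {B : Type*} [SkewBrace B]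

/-- A group of skew brace automorphisms acts on `Hom((B, ∘), ℤ_p^*)`. -/
@[reducible]
def circHomAction (p : ℕ) {K : Subgroup (MulAut B)} (hK : K ≤ autBrace B) :
    MulAction K (Circ B →* (ZMod p)ˣ) where
  smul g τ :=
    { toFun := fun b => τ (toCirc ((g⁻¹ : K).1 (toCirc.symm b)))
      map_one' := by
        rw [← toCirc_one, Equiv.symm_apply_apply, map_one, toCirc_one, map_one]
      map_mul' := fun a b =>
        (congrArg τ (hK (g⁻¹ : K).2 (toCirc.symm a) (toCirc.symm b))).trans (map_mul τ _ _) }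
  one_smul _ := rfl
  mul_smul g h τ := MonoidHom.ext fun b => by
    change τ (toCirc (((g * h)⁻¹ : K).1 (toCirc.symm b))) = _
    rw [mul_inv_rev]
    rfl

/-- The action is by composition with `g⁻¹`, to make it a left action; this form eliminates the
inverse. -/
theorem smul_circHom_eq_iff {K : Subgroup (MulAut B)} (hK : K ≤ autBrace B) (g : K)
    (τ τ' : Circ B →* (ZMod p)ˣ) :
    (circHomAction p hK).smul g τ = τ' ↔ ∀ b, τ' (toCirc (g.1 b)) = τ (toCirc b) := by
  constructor
  · rintro rfl b
    change τ (toCirc (g.1⁻¹ (g.1 b))) = _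
    rw [MulAut.inv_apply_self]
  · refine fun h => MonoidHom.ext fun b => ?_
    have h1 := h (g.1⁻¹ (toCirc.symm b))
    rw [MulAut.apply_inv_self] at h1
    exact h1.symm

/-- The group of skew brace automorphisms acts on `Hom(B, ℤ_p^*)`. -/
instance braceHomAction : MulAction (autBrace B) (braceHom B p) where
  smul g σ := ⟨σ.1.comp (g⁻¹ : autBrace B).1.toMonoidHom, fun a b => by
    refine Eq.trans ?_ (σ.2 _ _)
    exact congrArg σ.1 ((g⁻¹ : autBrace B).2 a b)⟩
  one_smul _ := rfl
  mul_smul g h σ := Subtype.ext (MonoidHom.ext fun b => by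
    change σ.1 (((g * h)⁻¹ : autBrace B).1 b) = _
    rw [mul_inv_rev]
    rfl)

theorem smul_braceHom_eq_iff (g : autBrace B) (σ σ' : braceHom B p) :
    g • σ = σ' ↔ ∀ b, σ'.1 (g.1 b) = σ.1 b := by
  constructor
  · rintro rfl b
    change σ.1 (g.1⁻¹ (g.1 b)) = _
    rw [MulAut.inv_apply_self]
  · refine fun h => Subtype.ext (MonoidHom.ext fun b => ?_)
    have h1 := h (g.1⁻¹ b)
    rw [MulAut.apply_inv_self] at h1
    exact h1.symm

instance finite_monoidHom {G H : Type*} [Group G] [Group H] [Finite G] [Finite H] :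
    Finite (G →* H) := DFunLike.finite _

instance finite_mulAut {G : Type*} [Group G] [Finite G] : Finite (MulAut G) := DFunLike.finite _

instance finite_circ {B : Type*} [Finite B] : Finite (Circ B) := ‹Finite B›

theorem card_circHom_orbits [Finite B] [NeZero p] {K : Subgroup (MulAut B)}
    (hK : K ≤ autBrace B) :
    letI := circHomAction p hK
    (Nat.card (MulAction.orbitRel.Quotient K (Circ B →* (ZMod p)ˣ)) : ℚ) =
      1 / (Nat.card K : ℚ) * ∑ᶠ τ : Circ B →* (ZMod p)ˣ, (Nat.card ↥(K ⊓ stabCirc τ) : ℚ) ∧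
    (Nat.card (MulAction.orbitRel.Quotient K (Circ B →* (ZMod p)ˣ)) : ℚ) =
      1 / (Nat.card K : ℚ) * ∑ᶠ g ∈ K, (Nat.card (fixCircHom p g) : ℚ) := by
  let _ := circHomAction p hK
  have h := card_orbits_eq_stabilizers (K := K) (X := Circ B →* (ZMod p)ˣ)
  refine ⟨h.1.trans ?_, h.2.trans ?_⟩
  · congr 1
    refine finsum_congr fun τ => ?_
    congr 1
    refine Nat.card_congr ⟨fun g => ⟨g.1.1, g.1.2, (smul_circHom_eq_iff hK _ _ _).1 g.2⟩,
      fun g => ⟨⟨g.1, g.2.1⟩, (smul_circHom_eq_iff hK _ _ _).2 g.2.2⟩, fun _ => rfl, fun _ => rfl⟩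
  · congr 1
    refine Eq.trans ?_ (finsum_set_coe_eq_finsum_mem (f := fun g => (Nat.card (fixCircHom p g) : ℚ))
      (K : Set (MulAut B)))
    refine finsum_congr fun g => ?_
    congr 1
    exact Nat.card_congr (Equiv.subtypeEquivRight fun τ => smul_circHom_eq_iff hK g τ τ)

theorem card_braceHom_orbits [Finite B] [NeZero p] :
    (Nat.card (MulAction.orbitRel.Quotient (autBrace B) (braceHom B p)) : ℚ) =
      1 / (Nat.card (autBrace B) : ℚ) *
        ∑ᶠ σ ∈ braceHom B p, (Nat.card ↥(autBrace B ⊓ stabDot σ) : ℚ) ∧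
    (Nat.card (MulAction.orbitRel.Quotient (autBrace B) (braceHom B p)) : ℚ) =
      1 / (Nat.card (autBrace B) : ℚ) *
        ∑ᶠ g ∈ autBrace B, (Nat.card (fixBraceHom p g) : ℚ) := by
  have h := card_orbits_eq_stabilizers (K := autBrace B) (X := braceHom B p)
  refine ⟨h.1.trans ?_, h.2.trans ?_⟩
  · congr 1
    rw [← finsum_set_coe_eq_finsum_mem
      (f := fun σ => (Nat.card ↥(autBrace B ⊓ stabDot σ) : ℚ)) (braceHom B p)]
    refine finsum_congr fun σ => ?_
    congr 1
    refine Nat.card_congr ⟨fun g => ⟨g.1.1, g.1.2, (smul_braceHom_eq_iff _ _ _).1 g.2⟩,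
      fun g => ⟨⟨g.1, g.2.1⟩, (smul_braceHom_eq_iff _ _ _).2 g.2.2⟩, fun _ => rfl, fun _ => rfl⟩
  · congr 1
    refine Eq.trans ?_ (finsum_set_coe_eq_finsum_mem (f := fun g => (Nat.card (fixBraceHom p g) : ℚ))
      (autBrace B : Set (MulAut B)))
    refine finsum_congr fun g => ?_
    congr 1
    refine Nat.card_congr ⟨fun σ => ⟨σ.1.1, σ.1.2, (smul_braceHom_eq_iff _ _ _).1 σ.2⟩,
      fun σ => ⟨⟨σ.1, σ.2.1⟩, (smul_braceHom_eq_iff _ _ _).2 σ.2.2⟩, fun _ => rfl, fun _ => rfl⟩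

end Actions

end SkewBrace

/-- A type that is partitioned by finitely many finite sets. -/
theorem card_eq_sum_of_partition {X Y : Type*} [Fintype Y] (S : Y → Set X)
    (hS : ∀ x, ∃! y, x ∈ S y) (hfin : ∀ y, (S y).Finite) :
    Nat.card X = ∑ y, (S y).ncard := by
  have := fun y => (hfin y).to_subtype
  choose f hf hf' using hS
  have h : ∀ x y, f x = y ↔ x ∈ S y := fun x y => ⟨fun h => h ▸ hf x, fun h => (hf' x y h).symm⟩
  rw [Nat.card_congr (Equiv.sigmaFiberEquiv f).symm,
    Nat.card_congr (Equiv.sigmaCongrRight fun y => Equiv.subtypeEquivRight fun x => h x y),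
    Nat.card_sigma]
  rfl

namespace FinSkewBrace

/-- The isomorphism classes of the skew braces of size `m` with the property `P`. -/
def classes (m : ℕ) (P : FinSkewBrace m → Prop) : Set (Quotient (isoSetoid m)) :=
  {q | ∃ C : FinSkewBrace m, P C ∧ Quotient.mk _ C = q}

theorem countWith_eq_ncard (m : ℕ) (P : FinSkewBrace m → Prop) :
    countWith m P = (classes m P).ncard := rfl

theorem mk_mem_classes {m : ℕ} {P : FinSkewBrace m → Prop}
    (hP : ∀ C D : FinSkewBrace m, Nonempty (Iso C D) → P C → P D) (C : FinSkewBrace m) :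
    Quotient.mk (isoSetoid m) C ∈ classes m P ↔ P C := by
  constructor
  · rintro ⟨D, hD, h⟩
    exact hP D C (Quotient.exact h) hD
  · exact fun h => ⟨C, h, rfl⟩

end FinSkewBrace

/-! ### Counting isomorphism classes -/

section Counting

variable {n p : ℕ}

theorem isUnit_card (hp : p.Prime) (hnp : ¬ p ∣ n) (B : FinSkewBrace n) :
    IsUnit (Nat.card B : ZMod p) := by
  rw [B.card_eq, ZMod.isUnit_iff_coprime]
  exact ((Nat.Prime.coprime_iff_not_dvd hp).2 hnp).symm

theorem coprime_card (hp : p.Prime) (hnp : ¬ p ∣ n) (B : FinSkewBrace n) :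
    (Nat.card B).Coprime p := by
  rw [B.card_eq]
  exact ((Nat.Prime.coprime_iff_not_dvd hp).2 hnp).symm

theorem isProduct_of_nonempty_iso (k : Bool) {B : FinSkewBrace n} {σ : B →* (ZMod p)ˣ}
    (C D : FinSkewBrace (n * p)) (f : Nonempty (Iso C D)) (h : ∃ τ, IsProduct k C σ τ) :
    ∃ τ, IsProduct k D σ τ :=
  h.imp fun _ h => h.of_iso f.some

theorem autStab_le {B : Type*} [SkewBrace B] (σ : B →* (ZMod p)ˣ) : autStab σ ≤ autBrace B :=
  inf_le_left

/-- The isomorphism classes of the products of a given kind via `σ` and some `τ` correspond to the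
orbits of `A_σ` on the set of all `τ`. -/
theorem classes_isProduct (hp : p.Prime) (hnp : ¬ p ∣ n) (k : Bool) (B : FinSkewBrace n)
    {σ : B →* (ZMod p)ˣ} (hσ : σ ∈ braceHom B p) :
    letI := circHomAction p (autStab_le σ)
    (classes (n * p) fun C => ∃ τ, IsProduct k C σ τ).Finite ∧
      (classes (n * p) fun C => ∃ τ, IsProduct k C σ τ).ncard =
        Nat.card (MulAction.orbitRel.Quotient (autStab σ) (Circ B →* (ZMod p)ˣ)) := by
  let _ := circHomAction p (autStab_le σ)
  have := NeZero.mk hp.ne_zero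
  have hB := isUnit_card hp hnp B
  have hB' := coprime_card hp hnp B
  choose C hC using exists_isProduct k hp.ne_zero B hσ
  let f : (Circ B →* (ZMod p)ˣ) → Quotient (isoSetoid (n * p)) := fun τ => Quotient.mk _ (C τ)
  have hrange : (classes (n * p) fun C => ∃ τ, IsProduct k C σ τ) = Set.range f := by
    ext q
    constructor
    · rintro ⟨D, ⟨τ, hτ⟩, rfl⟩
      exact ⟨τ, Quotient.sound ((hC τ).nonempty_iso hτ (Iso.refl _) (fun _ => rfl) fun _ => rfl)⟩
    · rintro ⟨τ, rfl⟩
      exact ⟨C τ, ⟨τ, hC τ⟩, rfl⟩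
  rw [hrange]
  refine ⟨Set.finite_range f, (card_orbits_eq_card_range (K := autStab σ) f ?_).symm⟩
  intro τ τ'
  constructor
  · intro h
    obtain ⟨e⟩ := Quotient.exact h
    obtain ⟨φ, π, hE⟩ := (hC τ).exists_ext hB
    obtain ⟨φ', π', hE'⟩ := (hC τ').exists_ext hB
    -- The inverse isomorphism is used because the orbit relation asks for `g • τ' = τ`.
    -- Compatibility with `σ` puts `g` into `A_σ`.
    obtain ⟨g, hg, hg'⟩ := exists_base_iso hB' hB' hE' hE e.symm
    exact ⟨⟨g.toMulEquiv, g.map_circ, hg⟩, (smul_circHom_eq_iff _ _ _ _).2 hg'⟩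
  · rintro ⟨g, hg⟩
    have hg' := (smul_circHom_eq_iff (autStab_le σ) _ _ _).1 hg
    have e : Nonempty (Iso (C τ') (C τ)) := (hC τ').nonempty_iso (hC τ)
      { g.1 with map_circ := g.2.1 } g.2.2 hg'
    exact Quotient.sound (e.map Iso.symm)

theorem countWith_isProduct (hp : p.Prime) (hnp : ¬ p ∣ n) (k : Bool) (B : FinSkewBrace n)
    {σ : B →* (ZMod p)ˣ} (hσ : σ ∈ braceHom B p) :
    (countWith (n * p) (fun C => ∃ τ, IsProduct k C σ τ) : ℚ) =
      1 / (Nat.card (autStab σ) : ℚ) *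
        ∑ᶠ τ : Circ B →* (ZMod p)ˣ, (Nat.card ↥(autStab σ ⊓ stabCirc τ) : ℚ) := by
  have := NeZero.mk hp.ne_zero
  rw [countWith_eq_ncard, (classes_isProduct hp hnp k B hσ).2]
  exact (card_circHom_orbits _).1

theorem not_both_kinds (hp : p.Prime) (hnp : ¬ p ∣ n) {B : FinSkewBrace n}
    {σ : B →* (ZMod p)ˣ} (hσ : σ ≠ 1) (C : FinSkewBrace (n * p)) :
    ¬ ((∃ τ, IsDoubleSemidirect C σ τ) ∧ ∃ τ, IsMirrorDoubleSemidirect C σ τ) := by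
  rintro ⟨⟨τ, h⟩, τ', h'⟩
  have hB := isUnit_card hp hnp B
  have hB' := coprime_card hp hnp B
  obtain ⟨φ, π, hE, hφ⟩ := (isDoubleSemidirect_iff hB).1 h
  obtain ⟨φ', π', hE', hφ'⟩ := (isMirrorDoubleSemidirect_iff hB).1 h'
  exact hσ (char_eq_one_of_both hB' hB' hE hE' hφ hφ')

theorem isMirror_one_iff {C B : Type*} [SkewBrace C] [SkewBrace B] {τ : Circ B →* (ZMod p)ˣ} :
    IsMirrorDoubleSemidirect C (1 : B →* (ZMod p)ˣ) τ ↔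
      IsDoubleSemidirect C (1 : B →* (ZMod p)ˣ) τ := by
  simp [IsMirrorDoubleSemidirect, IsDoubleSemidirect]

open Classical in
/-- The number of skew braces that are products of either kind via `σ`. -/
theorem classes_either (hp : p.Prime) (hnp : ¬ p ∣ n) (B : FinSkewBrace n)
    {σ : B →* (ZMod p)ˣ} (hσ : σ ∈ braceHom B p) :
    let S := classes (n * p) fun C =>
      ∃ τ, IsDoubleSemidirect C σ τ ∨ IsMirrorDoubleSemidirect C σ τ
    S.Finite ∧ (S.ncard : ℚ) = (if σ = 1 then 1 else 2) * (1 / (Nat.card (autStab σ) : ℚ) *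
        ∑ᶠ τ : Circ B →* (ZMod p)ˣ, (Nat.card ↥(autStab σ ⊓ stabCirc τ) : ℚ)) := by
  intro S
  have hd := (classes_isProduct hp hnp false B hσ).1
  have hm := (classes_isProduct hp hnp true B hσ).1
  have hS : S = (classes (n * p) fun C => ∃ τ, IsProduct false C σ τ) ∪
      (classes (n * p) fun C => ∃ τ, IsProduct true C σ τ) := by
    ext q
    constructor
    · rintro ⟨C, ⟨τ, h | h⟩, rfl⟩
      · exact Or.inl ⟨C, ⟨τ, h⟩, rfl⟩
      · exact Or.inr ⟨C, ⟨τ, h⟩, rfl⟩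
    · rintro (⟨C, ⟨τ, h⟩, rfl⟩ | ⟨C, ⟨τ, h⟩, rfl⟩)
      · exact ⟨C, ⟨τ, Or.inl h⟩, rfl⟩
      · exact ⟨C, ⟨τ, Or.inr h⟩, rfl⟩
  refine ⟨hS ▸ hd.union hm, ?_⟩
  have cd := countWith_isProduct hp hnp false B hσ
  have cm := countWith_isProduct hp hnp true B hσ
  rw [countWith_eq_ncard] at cd cm
  split_ifs with h1
  · subst h1
    rw [one_mul, ← cd, hS, Set.union_eq_self_of_subset_right]
    rintro q ⟨C, ⟨τ, h⟩, rfl⟩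
    exact ⟨C, ⟨τ, isMirror_one_iff.1 h⟩, rfl⟩
  · rw [two_mul, hS, Set.ncard_union_eq ?_ hd hm, Nat.cast_add, cd, cm]
    rw [Set.disjoint_left]
    rintro q ⟨C, hC, rfl⟩ hC'
    rw [mk_mem_classes (isProduct_of_nonempty_iso true)] at hC'
    exact not_both_kinds hp hnp h1 C ⟨hC, hC'⟩

theorem one_mem_braceHom {B : Type*} [SkewBrace B] : (1 : B →* (ZMod p)ˣ) ∈ braceHom B p :=
  fun _ _ => by simp

/-- The orbit of the trivial character is a single point, so every system of representatives
contains it. -/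
theorem one_mem_orbitReps {B : Type*} [SkewBrace B] {R : Set (B →* (ZMod p)ˣ)}
    (hR : IsOrbitReps R) : 1 ∈ R := by
  obtain ⟨r, ⟨hr, g, -, hg⟩, -⟩ := hR.2 1 one_mem_braceHom
  have : r = 1 := MonoidHom.ext fun b => (hg b).symm
  exact this ▸ hr

variable {ι : Type} {B : ι → FinSkewBrace n}

theorem iso_index_eq (hB : IsReps B) {i j : ι} (g : Iso (B i) (B j)) : i = j := by
  obtain ⟨k, -, hk⟩ := hB (B i)
  rw [hk i ⟨Iso.refl _⟩, hk j ⟨g⟩]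

/-- A pair `(B', σ)` is isomorphic to exactly one `(B i, r)` with `r` in the system `R i`. -/
theorem exists_rep_iso (hB : IsReps B) {R : ∀ i, Set (B i →* (ZMod p)ˣ)}
    (hR : ∀ i, IsOrbitReps (R i)) (B' : FinSkewBrace n) {σ : B' →* (ZMod p)ˣ}
    (hσ : σ ∈ braceHom B' p) :
    ∃ i, ∃ r ∈ R i, ∃ g : Iso B' (B i), ∀ b, r (g.toMulEquiv b) = σ b := by
  obtain ⟨i, ⟨g⟩, -⟩ := hB B'
  obtain ⟨r, ⟨hr, h, hh, hhr⟩, -⟩ := (hR i).2 (σ.comp g.toMulEquiv.symm.toMonoidHom)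
    (fun a b => (congrArg σ (g.symm.map_circ a b)).trans (hσ _ _))
  let h' : Iso (B i) (B i) := { h with map_circ := hh }
  refine ⟨i, r, hr, g.trans h'.symm, fun b => ?_⟩
  have h1 := hhr (h.symm (g.toMulEquiv b))
  rw [MulEquiv.apply_symm_apply] at h1
  exact h1.symm.trans (congrArg σ (g.toMulEquiv.symm_apply_apply b))

/-- Existence transports the extension structure of `C` to a chosen representative and applies the
dichotomy. For uniqueness, the identity of `C` induces an isomorphism between the quotients of any
two presentations, matching their additive characters. -/
theorem existsUnique_product (hp : p.Prime) (hnp : ¬ p ∣ n)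
    (hG : ∀ (G : Type) [Group G], Nat.card G = n * p →
      ∃ P : Subgroup G, P.Normal ∧ Nat.card P = p)
    (hB : IsReps B) {R : ∀ i, Set (B i →* (ZMod p)ˣ)} (hR : ∀ i, IsOrbitReps (R i))
    (C : FinSkewBrace (n * p)) : ∃! q : Σ i, R i,
      ∃ τ, IsDoubleSemidirect C q.2.1 τ ∨ IsMirrorDoubleSemidirect C q.2.1 τ := by
  obtain ⟨B', φ, π, σ, τ, h⟩ := exists_isBraceExt hp hnp hG C
  obtain ⟨i, r, hr, g, hg⟩ := exists_rep_iso hB hR B' (mem_braceHom_of_ext h.dot)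
  have h' := h.compIso g (σ' := r) (τ' := τ.comp g.circEquiv.symm.toMonoidHom) hg (fun b =>
    congrArg τ (g.circEquiv.symm_apply_apply b))
  refine ⟨⟨i, r, hr⟩, ⟨τ.comp g.circEquiv.symm.toMonoidHom, ?_⟩, ?_⟩
  · have hu := isUnit_card hp hnp (B i)
    rcases h'.circ_base_eq hp hu with hk | hk
    · exact Or.inl ((isDoubleSemidirect_iff hu).2 ⟨_, _, h', hk⟩)
    · exact Or.inr ((isMirrorDoubleSemidirect_iff hu).2 ⟨_, _, h', hk⟩)
  · rintro ⟨j, s, hs⟩ ⟨τ', hτ'⟩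
    obtain ⟨k, hk⟩ : ∃ k, IsProduct k C s τ' :=
      hτ'.elim (fun h => ⟨false, h⟩) (fun h => ⟨true, h⟩)
    obtain ⟨ψ, ρ, hE⟩ := hk.exists_ext (isUnit_card hp hnp (B j))
    obtain ⟨g', hg', -⟩ := exists_base_iso (coprime_card hp hnp (B j)) (coprime_card hp hnp (B i))
      hE h' (Iso.refl C)
    obtain rfl := iso_index_eq hB g'
    -- Both `s` and `r` represent the orbit of `r`.
    obtain ⟨t, -, ht⟩ := (hR j).2 r ((hR j).1 hr)
    have h1 : s = r := (ht s ⟨hs, g'.toMulEquiv, g'.map_circ, hg'⟩).trans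
      (ht r ⟨hr, 1, Subgroup.one_mem _, fun _ => rfl⟩).symm
    subst h1
    rfl

open Classical in
theorem count_eq_sum [Fintype ι] (hp : p.Prime) (hnp : ¬ p ∣ n)
    (hG : ∀ (G : Type) [Group G], Nat.card G = n * p →
      ∃ P : Subgroup G, P.Normal ∧ Nat.card P = p)
    (hB : IsReps B) {R : ∀ i, Set (B i →* (ZMod p)ˣ)} (hR : ∀ i, IsOrbitReps (R i)) :
    (FinSkewBrace.count (n * p) : ℚ) =
        ∑ i, (1 / (Nat.card (autStab (1 : B i →* (ZMod p)ˣ)) : ℚ) *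
            ∑ᶠ τ : Circ (B i) →* (ZMod p)ˣ,
              (Nat.card ↥(autStab (1 : B i →* (ZMod p)ˣ) ⊓ stabCirc τ) : ℚ) +
          2 * ∑ᶠ σ ∈ R i \ {1}, 1 / (Nat.card (autStab σ) : ℚ) *
            ∑ᶠ τ : Circ (B i) →* (ZMod p)ˣ, (Nat.card ↥(autStab σ ⊓ stabCirc τ) : ℚ)) := by
  have := NeZero.mk hp.ne_zero
  have := fun i => Fintype.ofFinite (R i)
  have hcl := fun i (σ : R i) => classes_either hp hnp (B i) ((hR i).1 σ.2)
  have key := card_eq_sum_of_partition (X := Quotient (isoSetoid (n * p)))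
    (fun q : Σ i, R i => classes (n * p) fun C =>
      ∃ τ, IsDoubleSemidirect C q.2.1 τ ∨ IsMirrorDoubleSemidirect C q.2.1 τ) (fun x => by
        induction x using Quotient.inductionOn with | h C => ?_
        have hmem : ∀ q : Σ i, R i, Quotient.mk (isoSetoid (n * p)) C ∈ (classes (n * p) fun C =>
            ∃ τ, IsDoubleSemidirect C q.2.1 τ ∨ IsMirrorDoubleSemidirect C q.2.1 τ) ↔
            ∃ τ, IsDoubleSemidirect C q.2.1 τ ∨ IsMirrorDoubleSemidirect C q.2.1 τ := fun q => by
          refine mk_mem_classes (fun C D f h => ?_) C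
          obtain ⟨τ, h | h⟩ := h
          · exact ⟨τ, Or.inl (IsProduct.of_iso (k := false) h f.some)⟩
          · exact ⟨τ, Or.inr (IsProduct.of_iso (k := true) h f.some)⟩
        simp only [hmem]
        exact existsUnique_product hp hnp hG hB hR C)
    (fun q => (hcl q.1 q.2).1)
  rw [FinSkewBrace.count, key, Fintype.sum_sigma, Nat.cast_sum]
  refine Finset.sum_congr rfl fun i _ => ?_
  rw [Nat.cast_sum, Finset.sum_congr rfl fun σ _ => (hcl i σ).2, ← finsum_eq_sum_of_fintype,
    finsum_set_coe_eq_finsum_mem (f := fun σ : B i →* (ZMod p)ˣ =>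
      (if σ = 1 then (1 : ℚ) else 2) * (1 / (Nat.card (autStab σ) : ℚ) *
        ∑ᶠ τ : Circ (B i) →* (ZMod p)ˣ, (Nat.card ↥(autStab σ ⊓ stabCirc τ) : ℚ))) (R i)]
  -- The trivial character is split off, as it alone has weight 1 instead of 2.
  have h1 : R i = insert 1 (R i \ {1}) := by
    rw [Set.insert_sdiff_singleton, Set.insert_eq_of_mem (one_mem_orbitReps (hR i))]
  conv_lhs => rw [h1]
  rw [finsum_mem_insert _ (by simp) (Set.toFinite _), if_pos rfl, one_mul]
  congr 1
  refine Eq.trans (finsum_mem_congr rfl fun σ hσ => ?_) (mul_finsum_mem _ _).symm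
  rw [if_neg (show σ ≠ 1 from hσ.2)]

/-- The invariance of `σ` under `λ` needs only the additive extension and that the projection is a
morphism of skew braces; no multiplicative character is required. -/
theorem SkewBrace.HasAdditiveStructure.mem_braceHom {C B : Type*} [SkewBrace C] [SkewBrace B]
    {σ : B →* (ZMod p)ˣ} (h : HasAdditiveStructure C σ) : σ ∈ braceHom B p := by
  obtain ⟨e, he, he'⟩ := h
  let π : Hom C B := { MonoidHom.mk' (fun c => (e c).2) (fun x y => by rw [he]) with
    map_circ := fun x y => he' x y }
  refine mem_braceHom_of_ext (φ := fun x => e.symm (x, 1)) (π := π) ⟨fun x y => ?_, fun x y h => ?_,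
    fun b => ⟨e.symm (0, b), by simp [π]⟩, fun c => ⟨fun h => ⟨(e c).1, ?_⟩, ?_⟩, fun g x => ?_⟩
  · exact e.injective (by rw [he]; simp)
  · exact congrArg Prod.fst (e.symm.injective h)
  · have h' : (e c).2 = 1 := h
    rw [← h']
    simp
  · rintro ⟨x, rfl⟩
    simp [π]
  · apply e.injective
    rw [he, he]
    simp only [Equiv.apply_symm_apply, map_one, Units.val_one, one_mul, mul_one, Prod.mk.injEq,
      and_true]
    exact add_comm _ _

theorem SkewBrace.IsDoubleSemidirect.hasAdditiveStructure {C B : Type*} [SkewBrace C] [SkewBrace B]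
    {σ : B →* (ZMod p)ˣ} {τ : Circ B →* (ZMod p)ˣ} (h : IsDoubleSemidirect C σ τ) :
    HasAdditiveStructure C σ := by
  obtain ⟨e, he, he'⟩ := h
  exact ⟨e, he, fun x y => by rw [he']⟩

/-- A pair `(B, σ)` is realized exactly when `σ` is a homomorphism for both operations; the double
semidirect product with `τ = 1` suffices for existence. -/
theorem additiveCount_eq_sum [Fintype ι] (hp : p.Prime) (hB : IsReps B) :
    NpAdditiveStructure.count n p = ∑ i,
      Nat.card (MulAction.orbitRel.Quotient (autBrace (B i)) (braceHom (B i) p)) := by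
  have := NeZero.mk hp.ne_zero
  let f : ∀ i, braceHom (B i) p → Quotient (NpAdditiveStructure.isoSetoid n p) := fun i σ =>
    Quotient.mk _ ⟨B i, σ.1, (exists_isDoubleSemidirect hp.ne_zero (B i) σ.2 1).imp fun _ h =>
      h.hasAdditiveStructure⟩
  have hf : ∀ i j σ τ, f i σ = f j τ ↔
      ∃ g : Iso (B i) (B j), ∀ b, τ.1 (g.toFun b) = σ.1 b := fun i j σ τ => Quotient.eq
  rw [NpAdditiveStructure.count, card_eq_sum_of_partition (fun i => Set.range (f i)) (fun x => ?_)
    fun i => Set.finite_range _]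
  · refine Finset.sum_congr rfl fun i _ => (card_orbits_eq_card_range (f i) fun σ τ => ?_).symm
    rw [eq_comm, hf]
    constructor
    · rintro ⟨g, hg⟩
      exact ⟨⟨g.toMulEquiv, g.map_circ⟩, (smul_braceHom_eq_iff _ _ _).2 hg⟩
    · rintro ⟨g, hg⟩
      exact ⟨{ g.1 with map_circ := g.2 }, (smul_braceHom_eq_iff _ _ _).1 hg⟩
  · induction x using Quotient.inductionOn with | h X => ?_
    obtain ⟨C, hC⟩ := X.realized
    obtain ⟨i, ⟨g⟩, -⟩ := hB X.B
    refine ⟨i, ⟨⟨X.σ.comp g.toMulEquiv.symm.toMonoidHom, fun a b =>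
      (congrArg X.σ (g.symm.map_circ a b)).trans (hC.mem_braceHom _ _)⟩, ?_⟩, ?_⟩
    · refine Quotient.sound ⟨g.symm, fun b => rfl⟩
    · rintro j ⟨σ, hσ⟩
      obtain ⟨g', -⟩ := Quotient.exact hσ
      obtain ⟨k, -, hk⟩ := hB X.B
      exact (hk j ⟨g'.symm⟩).trans (hk i ⟨g⟩).symm

end Counting

theorem mainTheorem5 (n p : ℕ) (hn : 0 < n) (hp : p.Prime) (hnp : ¬ p ∣ n)
    (hG : ∀ (G : Type) [Group G], Nat.card G = n * p →
      ∃ P : Subgroup G, P.Normal ∧ Nat.card P = p)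
    {ι : Type} [Fintype ι] (B : ι → FinSkewBrace n) (hB : IsReps B)
    (R : ∀ i, Set (B i →* (ZMod p)ˣ)) (hR : ∀ i, IsOrbitReps (R i)) :
    -- the number of additive structures, by stabilizers and by fixed points
    (NpAdditiveStructure.count n p : ℚ) =
        ∑ i, 1 / (Nat.card (autBrace (B i)) : ℚ) *
          ∑ᶠ σ ∈ braceHom (B i) p, (Nat.card ↥(autBrace (B i) ⊓ stabDot σ) : ℚ) ∧
    (NpAdditiveStructure.count n p : ℚ) =
        ∑ i, 1 / (Nat.card (autBrace (B i)) : ℚ) *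
          ∑ᶠ g ∈ autBrace (B i), (Nat.card (fixBraceHom p g) : ℚ) ∧
    -- the total number, by stabilizers and by fixed points
    (FinSkewBrace.count (n * p) : ℚ) =
        ∑ i, (1 / (Nat.card (autStab (1 : B i →* (ZMod p)ˣ)) : ℚ) *
            ∑ᶠ τ : Circ (B i) →* (ZMod p)ˣ,
              (Nat.card ↥(autStab (1 : B i →* (ZMod p)ˣ) ⊓ stabCirc τ) : ℚ) +
          2 * ∑ᶠ σ ∈ R i \ {1}, 1 / (Nat.card (autStab σ) : ℚ) *
            ∑ᶠ τ : Circ (B i) →* (ZMod p)ˣ, (Nat.card ↥(autStab σ ⊓ stabCirc τ) : ℚ)) ∧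
    (FinSkewBrace.count (n * p) : ℚ) =
        ∑ i, (1 / (Nat.card (autStab (1 : B i →* (ZMod p)ˣ)) : ℚ) *
            ∑ᶠ g ∈ autStab (1 : B i →* (ZMod p)ˣ), (Nat.card (fixCircHom p g) : ℚ) +
          2 * ∑ᶠ σ ∈ R i \ {1}, 1 / (Nat.card (autStab σ) : ℚ) *
            ∑ᶠ g ∈ autStab σ, (Nat.card (fixCircHom p g) : ℚ)) ∧
    -- the case `σ = 1`: semidirect products
    (∀ i, autStab (1 : B i →* (ZMod p)ˣ) = autBrace (B i) ∧
      (countWith (n * p) (fun C => ∃ τ, IsDoubleSemidirect C (1 : B i →* (ZMod p)ˣ) τ) : ℚ) =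
        1 / (Nat.card (autStab (1 : B i →* (ZMod p)ˣ)) : ℚ) *
          ∑ᶠ τ : Circ (B i) →* (ZMod p)ˣ,
            (Nat.card ↥(autStab (1 : B i →* (ZMod p)ˣ) ⊓ stabCirc τ) : ℚ)) ∧
    -- the cases `σ ≠ 1`: the two kinds of double semidirect products
    (∀ i, ∀ σ ∈ R i, σ ≠ 1 →
      (countWith (n * p) (fun C => ∃ τ, IsDoubleSemidirect C σ τ) : ℚ) =
        1 / (Nat.card (autStab σ) : ℚ) *
          ∑ᶠ τ : Circ (B i) →* (ZMod p)ˣ, (Nat.card ↥(autStab σ ⊓ stabCirc τ) : ℚ) ∧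
      (countWith (n * p) (fun C => ∃ τ, IsMirrorDoubleSemidirect C σ τ) : ℚ) =
        1 / (Nat.card (autStab σ) : ℚ) *
          ∑ᶠ τ : Circ (B i) →* (ZMod p)ˣ, (Nat.card ↥(autStab σ ⊓ stabCirc τ) : ℚ) ∧
      ∀ C : FinSkewBrace (n * p),
        ¬ ((∃ τ, IsDoubleSemidirect C σ τ) ∧ ∃ τ, IsMirrorDoubleSemidirect C σ τ)) ∧
    -- every skew brace of size `np` occurs, for exactly one `B i` and one `σ ∈ R i`
    (∀ C : FinSkewBrace (n * p), ∃! q : Σ i, R i,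
      ∃ τ, IsDoubleSemidirect C q.2.1 τ ∨ IsMirrorDoubleSemidirect C q.2.1 τ) := by
  have := NeZero.mk hp.ne_zero
  have hstab := fun i (σ : B i →* (ZMod p)ˣ) => card_circHom_orbits (p := p) (autStab_le σ)
  have hfix := fun i (σ : B i →* (ZMod p)ˣ) => (hstab i σ).1.symm.trans (hstab i σ).2
  have hcount := count_eq_sum hp hnp hG hB hR
  refine ⟨?_, ?_, hcount, ?_, fun i => ⟨?_, ?_⟩, fun i σ hσ h1 => ⟨?_, ?_, ?_⟩, ?_⟩
  · rw [additiveCount_eq_sum hp hB, Nat.cast_sum]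
    exact Finset.sum_congr rfl fun i _ => card_braceHom_orbits.1
  · rw [additiveCount_eq_sum hp hB, Nat.cast_sum]
    exact Finset.sum_congr rfl fun i _ => card_braceHom_orbits.2
  · rw [hcount]
    refine Finset.sum_congr rfl fun i _ => ?_
    simp only [hfix]
  · refine inf_eq_left.2 fun g _ b => ?_
    rfl
  · exact countWith_isProduct hp hnp false (B i) one_mem_braceHom
  · exact countWith_isProduct hp hnp false (B i) ((hR i).1 hσ)
  · exact countWith_isProduct hp hnp true (B i) ((hR i).1 hσ)
  · exact not_both_kinds hp hnp h1
  · exact existsUnique_product hp hnp hG hB hR
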